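/- Let $P$ be a (Hausdorff, finite-dimensional, real) smooth manifold with a Poisson bracket $\{\cdot,\cdot\}$ on $C^\infty(P)$, and let $\mathrm{Car}(P)$ be the space of its Casimir functions, i.e. of all $c\in C^\infty(P)$ with $\{c,f\}=0$ for every $f\in C^\infty(P)$. Let $G$ be a finite-dimensional real Lie group with Lie algebra $\mathfrak g$, equipped with the zero Poisson structure, acting smoothly on $P$ from the left by a Poisson action (so every $x\mapsto gx$ preserves the Poisson bracket), and let $\lambda(X)$, $X\in\mathfrak g$, be the infinitesimal action, $(\lambda(X)f)(x)=\frac{d}{dt}\big|_{t=0}f(e^{tX}x)$. Assume that the action is tangential (every $\lambda(X)$ is tangent to the symplectic leaves of $P$) and let $m:P\to\mathfrak g^*$ be a momentum map: a smooth map whose components $m(X)=\langle m(\cdot),X\rangle$ satisfy $\lambda(X)f=\{f,m(X)\}$ for all $X\in\mathfrak g$ and $f\in C^\infty(P)$. Put $\mathrm{Ad}^*_g\xi=\xi\circ\mathrm{Ad}_{g^{-1}}$ for $\xi\in\mathfrak g^*$ and $\Sigma(g,x)=m(gx)-\mathrm{Ad}^*_g m(x)\in\mathfrak g^*$; a momentum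 map $m'$ is called coadjoint-equivariant if $m'(gx)=\mathrm{Ad}^*_g m'(x)$ for all $g\in G$, $x\in P$. Then: 1. For $X,Y\in\mathfrak g$ the function $\Gamma_{X,Y}(x)=\langle d_e\Sigma(\cdot,x)(X),Y\rangle$ equals $m([X,Y])-\{m(X),m(Y)\}$ and is a Casimir function, and $\Gamma$ is a $2$-cocycle of $\mathfrak g$ with values in the trivial $\mathfrak g$-module $\mathrm{Car}(P)$. 2. Suppose that $G$ is connected. Then $\Psi(g)(Y)=\langle\Sigma(g,\cdot),Y\rangle$ is a Casimir function for all $g\in G$, $Y\in\mathfrak g$, and $\Psi$ is a $1$-cocycle of $G$ with values in the space $L(\mathfrak g,\mathrm{Car}(P))\cong\mathfrak g^*\otimes\mathrm{Car}(P)$ of linear maps, on which $G$ acts by $(g\cdot c)(Y)=c(\mathrm{Ad}_{g^{-1}}Y)$; that is, $\Psi(gh)=\Psi(g)+g\cdot\Psi(h)$. The action admits a coadjoint-equivariant momentum map if and only if $\Psi$ is cohomologous to zero, i.e. there is $c\in L(\mathfrak g,\mathrm{Car}(P))$ with $\Psi(g)=g\cdot c-c$ for all $g\in G$. 3. If $G$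 is compact, then the action admits a coadjoint-equivariant momentum map. 4. If $H^1(\mathfrak g,\mathrm{Car}(P))=0$ and $H^2(\mathfrak g,\mathrm{Car}(P))=0$ (Lie algebra cohomology with coefficients in the trivial module $\mathrm{Car}(P)$), then the action admits a coadjoint-equivariant momentum map. In particular, if $\mathfrak g$ is semisimple, then both cohomology spaces vanish and the action admits a coadjoint-equivariant momentum map. -/

import Mathlib

open scoped Manifold ContDiff

noncomputable section

namespace TangentialPoisson

/-! ### Poisson manifolds -/

section Poisson

variable (F : Type*) [NormedAddCommGroup F] [NormedSpace ℝ F]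
  (P : Type*) [TopologicalSpace P] [ChartedSpace F P]

/-- The algebra of smooth real functions on the manifold `P`. -/
abbrev Smooth : Type _ := C^∞⟮𝓘(ℝ, F), P; 𝓘(ℝ, ℝ), ℝ⟯

/-- A Poisson structure on `P`: the structure of a Poisson algebra on `C^∞(P)`. -/
structure PoissonStructure where
  /-- the Poisson bracket `{f, h}` -/
  bracket : Smooth F P →ₗ[ℝ] Smooth F P →ₗ[ℝ] Smooth F P
  alternating : ∀ f, bracket f f = 0
  jacobi : ∀ f h k,
    bracket f (bracket h k) + bracket h (bracket k f) + bracket k (bracket f h) = 0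
  leibniz : ∀ f h k, bracket (f * h) k = f * bracket h k + bracket f k * h

variable {F P}

/-- `Car(P)`: the space of Casimir functions, i.e. of smooth functions that Poisson commute with
all smooth functions. -/
def Casimir (π : PoissonStructure F P) : Submodule ℝ (Smooth F P) where
  carrier := {c | ∀ f, π.bracket c f = 0}
  add_mem' {a b} ha hb f := by simp [ha f, hb f]
  zero_mem' f := by simp
  smul_mem' t c hc f := by simp [hc f]

end Poisson

/-! ### The Lie group, its adjoint representation and the coadjoint module -/

section LieGroup

/-- A smooth Lie group is regular enough for Mathlib's Lie algebra of a Lie group. -/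
instance instLieGroupMinSmoothness {E : Type*} [NormedAddCommGroup E] [NormedSpace ℝ E]
    {G : Type*} [TopologicalSpace G] [ChartedSpace E G] [Group G] [LieGroup 𝓘(ℝ, E) ∞ G] :
    LieGroup 𝓘(ℝ, E) (minSmoothness ℝ 3) G :=
  LieGroup.of_le (n := ∞) (by
    rw [minSmoothness_of_isRCLikeNormedField]; exact ENat.LEInfty.out)

/-- The adjoint action `Ad_g`: the differential at `1` of the conjugation `h ↦ g h g⁻¹`.
(That differential takes values in the tangent space at `g * 1 * g⁻¹`, which is the point `1`.) -/
def Ad (E : Type*) [NormedAddCommGroup E] [NormedSpace ℝ E] {G : Type*} [TopologicalSpace G]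
    [ChartedSpace E G] [Group G] (g : G) :
    GroupLieAlgebra 𝓘(ℝ, E) G →ₗ[ℝ] GroupLieAlgebra 𝓘(ℝ, E) G where
  toFun X := mfderiv 𝓘(ℝ, E) 𝓘(ℝ, E) (fun h : G ↦ g * h * g⁻¹) 1 X
  map_add' X Y := map_add (mfderiv 𝓘(ℝ, E) 𝓘(ℝ, E) (fun h : G ↦ g * h * g⁻¹) 1) X Y
  map_smul' t X := map_smul (mfderiv 𝓘(ℝ, E) 𝓘(ℝ, E) (fun h : G ↦ g * h * g⁻¹) 1) t X

variable {E : Type*} [NormedAddCommGroup E] [NormedSpace ℝ E]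
  {G : Type*} [TopologicalSpace G] [ChartedSpace E G] [Group G]

theorem Ad_one : Ad E (1 : G) = LinearMap.id := by
  ext X
  have h : (fun h : G ↦ 1 * h * 1⁻¹) = id := by ext h; simp
  change mfderiv 𝓘(ℝ, E) 𝓘(ℝ, E) (fun h : G ↦ 1 * h * 1⁻¹) 1 X = X
  rw [h, mfderiv_id]
  rfl

theorem Ad_mul [LieGroup 𝓘(ℝ, E) ∞ G] (g h : G) : Ad E (g * h) = Ad E g ∘ₗ Ad E h := by
  have hs : ∀ a : G, MDifferentiable 𝓘(ℝ, E) 𝓘(ℝ, E) (fun k : G ↦ a * k * a⁻¹) := fun a ↦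
    ((contMDiff_mul_right (I := 𝓘(ℝ, E)) (n := ∞) (a := a⁻¹)).comp
      (contMDiff_mul_left (I := 𝓘(ℝ, E)) (n := ∞) (a := a))).mdifferentiable (by simp)
  ext X
  have hc : (fun k : G ↦ g * h * k * (g * h)⁻¹) =
      (fun k : G ↦ g * k * g⁻¹) ∘ (fun k : G ↦ h * k * h⁻¹) := by
    ext k; simp [mul_assoc]
  have h1 : h * 1 * h⁻¹ = (1 : G) := by simp
  change mfderiv 𝓘(ℝ, E) 𝓘(ℝ, E) (fun k : G ↦ g * h * k * (g * h)⁻¹) 1 X =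
    mfderiv 𝓘(ℝ, E) 𝓘(ℝ, E) (fun k : G ↦ g * k * g⁻¹) 1
      (mfderiv 𝓘(ℝ, E) 𝓘(ℝ, E) (fun k : G ↦ h * k * h⁻¹) 1 X)
  rw [hc, mfderiv_comp (I' := 𝓘(ℝ, E)) 1 (hs g _) (hs h _)]
  have key : ∀ a : G, a = 1 → ∀ v : E,
      (mfderiv 𝓘(ℝ, E) 𝓘(ℝ, E) (fun k : G ↦ g * k * g⁻¹) a v : E) =
      (mfderiv 𝓘(ℝ, E) 𝓘(ℝ, E) (fun k : G ↦ g * k * g⁻¹) 1 v : E) := by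
    rintro a rfl v; rfl
  exact key _ h1 _

/-- For a vector space `V`, the coadjoint representation of `G` on the space `L(𝔤, V)` of linear
maps `𝔤 → V` (that is, on `𝔤* ⊗ V`, with `V` carrying the trivial action):
`(g · c)(Y) = c(Ad_{g⁻¹} Y)`. -/
def coadjointRep (E : Type*) [NormedAddCommGroup E] [NormedSpace ℝ E]
    (G : Type*) [TopologicalSpace G] [ChartedSpace E G] [Group G] [LieGroup 𝓘(ℝ, E) ∞ G]
    (V : Type*) [AddCommGroup V] [Module ℝ V] :
    Representation ℝ G (GroupLieAlgebra 𝓘(ℝ, E) G →ₗ[ℝ] V) where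
  toFun g :=
    { toFun := fun c ↦ c ∘ₗ Ad E g⁻¹
      map_add' := fun _ _ ↦ rfl
      map_smul' := fun _ _ ↦ rfl }
  map_one' := by
    refine LinearMap.ext fun c ↦ ?_
    change c ∘ₗ Ad E (1 : G)⁻¹ = c
    rw [inv_one, Ad_one, LinearMap.comp_id]
  map_mul' g h := by
    refine LinearMap.ext fun c ↦ ?_
    change c ∘ₗ Ad E (g * h)⁻¹ = (c ∘ₗ Ad E h⁻¹) ∘ₗ Ad E g⁻¹
    rw [mul_inv_rev, Ad_mul, LinearMap.comp_assoc]

end LieGroup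

/-! ### Cohomology -/

section Cohomology

/-- `Ψ` is a `1`-cocycle of the group `G` with values in the representation `ρ`. -/
def IsGroupOneCocycle {G V : Type*} [Group G] [AddCommGroup V] [Module ℝ V]
    (ρ : Representation ℝ G V) (Ψ : G → V) : Prop :=
  ∀ g h : G, Ψ (g * h) = Ψ g + ρ g (Ψ h)

/-- `Ψ` is a `1`-coboundary of the group `G` with values in the representation `ρ`. -/
def IsGroupOneCoboundary {G V : Type*} [Group G] [AddCommGroup V] [Module ℝ V]
    (ρ : Representation ℝ G V) (Ψ : G → V) : Prop :=
  ∃ c : V, ∀ g : G, Ψ g = ρ g c - c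

variable (L : Type*) [LieRing L] [LieAlgebra ℝ L]
  (M : Type*) [AddCommGroup M] [Module ℝ M] [LieRingModule L M] [LieModule ℝ L M]

/-- The Chevalley-Eilenberg differential from `0`-cochains to `1`-cochains:
`v ↦ (x ↦ ⁅x, v⁆)`. -/
def lieD₀₁ : M →ₗ[ℝ] LieModule.Cohomology.oneCochain ℝ L M :=
  (LieModule.toEnd ℝ L M : L →ₗ[ℝ] Module.End ℝ M).flip

/-- `H¹(L, M) = 0`: every `1`-cocycle is a `1`-coboundary. -/
def LieH1Vanishes : Prop :=
  LinearMap.ker (LieModule.Cohomology.d₁₂ ℝ L M) ≤ LinearMap.range (lieD₀₁ L M)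

/-- `H²(L, M) = 0`: every `2`-cocycle is a `2`-coboundary. -/
def LieH2Vanishes : Prop :=
  LieModule.Cohomology.twoCocycle ℝ L M ≤ LinearMap.range (LieModule.Cohomology.d₁₂ ℝ L M)

end Cohomology

/-! ### Tangential Poisson actions and momentum maps -/

section Action

variable (E : Type*) [NormedAddCommGroup E] [NormedSpace ℝ E]
  {F : Type*} [NormedAddCommGroup F] [NormedSpace ℝ F]
  (G : Type*) [TopologicalSpace G] [ChartedSpace E G] [Group G]
  {P : Type*} [TopologicalSpace P] [ChartedSpace F P] [MulAction G P]

/-- The function `f ∘ σ_g`, where `σ_g x = g • x`. -/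
def translate {G : Type*} [TopologicalSpace G] [ChartedSpace E G] [Group G] [MulAction G P]
    [ContMDiffSMul 𝓘(ℝ, E) 𝓘(ℝ, F) ∞ G P] (g : G) (f : Smooth F P) : Smooth F P :=
  ⟨fun x ↦ f (g • x), f.contMDiff.comp
    ((contMDiff_smul (I := 𝓘(ℝ, E)) (I' := 𝓘(ℝ, F)) (n := ∞) (G := G) (M := P)).comp
      (contMDiff_const.prodMk contMDiff_id))⟩

/-- The action of `G`, with the zero Poisson structure on `G`, is a Poisson action: every
`σ_g` preserves the Poisson structure of `P`. -/
def IsPoissonAction [ContMDiffSMul 𝓘(ℝ, E) 𝓘(ℝ, F) ∞ G P] (π : PoissonStructure F P) : Prop :=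
  ∀ (g : G) (f h : Smooth F P),
    π.bracket (translate E g f) (translate E g h) = translate E g (π.bracket f h)

variable {E G}

/-- The infinitesimal action `λ(X)`, a vector field on `P`, acting on functions:
`(λ(X) f)(x) = ⟨d(f ∘ σ_x)(1), X⟩` with `σ_x g = g • x`, i.e. the derivative at `t = 0` of
`f (exp (t X) • x)`. -/
def infinitesimalAction (X : GroupLieAlgebra 𝓘(ℝ, E) G) (f : Smooth F P) (x : P) : ℝ :=
  mfderiv 𝓘(ℝ, E) 𝓘(ℝ, ℝ) (fun g : G ↦ f (g • x)) 1 X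

variable (E G) in
/-- The action is tangential: every `λ(X)` is tangent to the symplectic leaves of `P`; the tangent
space of the leaf through `x` consists of the values at `x` of the Hamiltonian vector fields. -/
def IsTangential (π : PoissonStructure F P) : Prop :=
  ∀ (X : GroupLieAlgebra 𝓘(ℝ, E) G) (x : P), ∃ k : Smooth F P,
    ∀ f : Smooth F P, infinitesimalAction X f x = π.bracket k f x

variable (E F G P) in
/-- A smooth map from `P` to the dual `𝔤*` of the Lie algebra of `G`; as `𝔤` is finite
dimensional, smoothness is smoothness of all components. -/
structure SmoothMapToDual where
  /-- the underlying map -/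
  toFun : P → Module.Dual ℝ (GroupLieAlgebra 𝓘(ℝ, E) G)
  smooth : ∀ X : GroupLieAlgebra 𝓘(ℝ, E) G,
    ContMDiff 𝓘(ℝ, F) 𝓘(ℝ, ℝ) ∞ (fun x ↦ toFun x X)

/-- The component `m(X) ∈ C^∞(P)` of `m : P → 𝔤*`. -/
def SmoothMapToDual.component (m : SmoothMapToDual E F G P) (X : GroupLieAlgebra 𝓘(ℝ, E) G) :
    Smooth F P :=
  ⟨fun x ↦ m.toFun x X, m.smooth X⟩

/-- `m : P → 𝔤*` is a momentum map: `λ(X)` is the Hamiltonian vector field `{·, m(X)}`. -/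
def IsMomentumMap (π : PoissonStructure F P) (m : SmoothMapToDual E F G P) : Prop :=
  ∀ (X : GroupLieAlgebra 𝓘(ℝ, E) G) (f : Smooth F P) (x : P),
    infinitesimalAction X f x = π.bracket f (m.component X) x

/-- `Σ(g, x) = m(g x) - Ad*_g m(x) ∈ 𝔤*`, where `⟨Ad*_g ξ, Y⟩ = ⟨ξ, Ad_{g⁻¹} Y⟩`. -/
def SmoothMapToDual.defect (m : SmoothMapToDual E F G P) (g : G) (x : P) :
    Module.Dual ℝ (GroupLieAlgebra 𝓘(ℝ, E) G) :=
  m.toFun (g • x) - m.toFun x ∘ₗ Ad E g⁻¹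

/-- `m` intertwines the action on `P` with the coadjoint action on `𝔤*`. -/
def SmoothMapToDual.IsCoadjointEquivariant (m : SmoothMapToDual E F G P) : Prop :=
  ∀ (g : G) (x : P), m.toFun (g • x) = m.toFun x ∘ₗ Ad E g⁻¹

variable (E G) in
/-- The action of `G` on `P` has a coadjoint-equivariant momentum map. -/
def HasEquivariantMomentumMap (π : PoissonStructure F P) : Prop :=
  ∃ m : SmoothMapToDual E F G P, IsMomentumMap π m ∧ m.IsCoadjointEquivariant

variable (E G) in
/-- `Car(P)` as a trivial module over the Lie algebra of `G`. -/
abbrev TrivialCasimir [CompleteSpace E] [LieGroup 𝓘(ℝ, E) ∞ G] (π : PoissonStructure F P) :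
    Type _ :=
  TrivialLieModule ℝ (GroupLieAlgebra 𝓘(ℝ, E) G) (Casimir π)

end Action

end TangentialPoisson

end

open TangentialPoisson

open scoped Manifold ContDiff

set_option linter.unusedSectionVars false

noncomputable section

namespace TangentialPoisson

open Filter Topology

/-! ### Symmetry of mixed partial derivatives. -/

section Calculus

variable {E : Type*} [NormedAddCommGroup E] [NormedSpace ℝ E]
  {E' : Type*} [NormedAddCommGroup E'] [NormedSpace ℝ E']
  {V : Type*} [NormedAddCommGroup V] [NormedSpace ℝ V]

/-! Since `λ(X)` is the Hamiltonian field of `m(X)`, the action determines `m(X)` up to a Casimir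
function, so every failure of equivariance is Casimir-valued. Two facts make this precise. The map
`λ` reverses brackets, so `m([X, Y])` and `{m(X), m(Y)}` have the same Hamiltonian field
(`IsMomentumMap.bracket_component_lie`). As the action is Poisson, `m(Y) ∘ σ_g` and `m(Ad_{g⁻¹} Y)`
do too (`IsMomentumMap.bracket_translate`). That the derivative of `Σ` at the identity is `Γ` rests
on `derivOne_adInv`: the derivative of `g ↦ Ad_{g⁻¹} Y` in direction `X` is `-[X, Y]`.

Every `λ(X)` kills Casimir functions, so they are invariant under the identity component; this turns
the composition rule for `Σ` into the cocycle identity (`casimirDefect_mul`). The momentum maps form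
an affine space over `L(𝔤, Car(P))`, and for connected `G` adding `c` to `m` subtracts `g · c - c`
from `Ψ(g)`.

For compact `G` one averages `Ad*_g m(g⁻¹ x)` over Haar measure. The average is smooth and differs
from `m` by Casimir functions because all `Ψ(g)(Y)` lie in one finite-dimensional space, which is
closed under pointwise means (`exists_eq_integral`).

If `H²` vanishes, `m` can be corrected so that `X ↦ m(X)` preserves brackets. Each `Ψ(g)` then
vanishes on brackets, hence is a `1`-cocycle, and is zero if `H¹` vanishes; connectedness plays no
role. For semisimple `𝔤` both vanishing statements come from the Killing form. -/

theorem fderiv_partial_right {f : E → E' → V} {u₀ : E} {v₀ : E'}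
    (hf : DifferentiableAt ℝ (Function.uncurry f) (u₀, v₀)) (Y : E') :
    fderiv ℝ (f u₀) v₀ Y = fderiv ℝ (Function.uncurry f) (u₀, v₀) (0, Y) := by
  have h : HasFDerivAt (fun v : E' ↦ (u₀, v)) (ContinuousLinearMap.inr ℝ E E') v₀ :=
    hasFDerivAt_prodMk_right u₀ v₀
  have h2 : HasFDerivAt (f u₀) _ v₀ := hf.hasFDerivAt.comp v₀ h
  rw [h2.fderiv]
  simp

theorem fderiv_partial_left {f : E → E' → V} {u₀ : E} {v₀ : E'}
    (hf : DifferentiableAt ℝ (Function.uncurry f) (u₀, v₀)) (X : E) :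
    fderiv ℝ (fun u ↦ f u v₀) u₀ X = fderiv ℝ (Function.uncurry f) (u₀, v₀) (X, 0) := by
  have h : HasFDerivAt (fun u : E ↦ (u, v₀)) (ContinuousLinearMap.inl ℝ E E') u₀ :=
    hasFDerivAt_prodMk_left u₀ v₀
  have h2 : HasFDerivAt (fun u ↦ f u v₀) _ u₀ :=
    HasFDerivAt.comp (g := Function.uncurry f) u₀ hf.hasFDerivAt h
  rw [h2.fderiv]
  simp

/-- Mixed partial derivatives of a `C^2` function of two variables agree. -/
theorem fderiv_fderiv_comm {f : E → E' → V} {u₀ : E} {v₀ : E'}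
    (hf : ContDiffAt ℝ 2 (Function.uncurry f) (u₀, v₀)) (X : E) (Y : E') :
    fderiv ℝ (fun u ↦ fderiv ℝ (f u) v₀ Y) u₀ X =
      fderiv ℝ (fun v ↦ fderiv ℝ (fun u ↦ f u v) u₀ X) v₀ Y := by
  set F := Function.uncurry f
  have hev : ∀ᶠ p in 𝓝 (u₀, v₀), DifferentiableAt ℝ F p :=
    (hf.eventually (by simp)).mono fun p hp ↦ hp.differentiableAt (by simp)
  have hd : DifferentiableAt ℝ (fderiv ℝ F) (u₀, v₀) :=
    (hf.fderiv_right (m := 1) (by norm_num)).differentiableAt (by simp)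
  have hsymm := hf.isSymmSndFDerivAt (by simp)
  have h1 : (fun u ↦ fderiv ℝ (f u) v₀ Y) =ᶠ[𝓝 u₀] fun u ↦ fderiv ℝ F (u, v₀) (0, Y) := by
    have : Tendsto (fun u ↦ (u, v₀)) (𝓝 u₀) (𝓝 (u₀, v₀)) := by
      exact (Continuous.prodMk_left v₀).tendsto u₀
    filter_upwards [this.eventually hev] with u hu using fderiv_partial_right hu Y
  have h2 : (fun v ↦ fderiv ℝ (fun u ↦ f u v) u₀ X) =ᶠ[𝓝 v₀] fun v ↦ fderiv ℝ F (u₀, v) (X, 0) := by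
    have : Tendsto (fun v ↦ (u₀, v)) (𝓝 v₀) (𝓝 (u₀, v₀)) := by
      exact (Continuous.prodMk_right u₀).tendsto v₀
    filter_upwards [this.eventually hev] with v hv using fderiv_partial_left hv X
  rw [h1.fderiv_eq, h2.fderiv_eq]
  have e1 : HasFDerivAt (fun u ↦ fderiv ℝ F (u, v₀) (0, Y)) _ u₀ :=
    ((hd.hasFDerivAt.comp u₀ (hasFDerivAt_prodMk_left u₀ v₀)).clm_apply
      (hasFDerivAt_const ((0 : E), Y) u₀))
  have e2 : HasFDerivAt (fun v ↦ fderiv ℝ F (u₀, v) (X, 0)) _ v₀ :=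
    ((hd.hasFDerivAt.comp v₀ (hasFDerivAt_prodMk_right u₀ v₀)).clm_apply
      (hasFDerivAt_const (X, (0 : E')) v₀))
  rw [e1.fderiv, e2.fderiv]
  simpa using hsymm (X, 0) (0, Y)

end Calculus

/-! ### Differentiation at the identity in the preferred chart. -/

section DerivOne

variable {E : Type*} [NormedAddCommGroup E] [NormedSpace ℝ E]
  {G : Type*} [TopologicalSpace G] [ChartedSpace E G] [Group G]
  {V : Type*} [NormedAddCommGroup V] [NormedSpace ℝ V]

variable (E) in
/-- The derivative at `1` of a vector-valued function, read in the preferred chart at `1`. -/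
def derivOne (f : G → V) : E →L[ℝ] V :=
  fderiv ℝ (fun u ↦ f ((extChartAt 𝓘(ℝ, E) (1 : G)).symm u)) (extChartAt 𝓘(ℝ, E) (1 : G) 1)

theorem mdifferentiableAt_of_extChartAt {M : Type*} [TopologicalSpace M] [ChartedSpace E M]
    {f : M → V} {x : M}
    (hf : DifferentiableAt ℝ (fun u ↦ f ((extChartAt 𝓘(ℝ, E) x).symm u))
      (extChartAt 𝓘(ℝ, E) x x)) :
    MDifferentiableAt 𝓘(ℝ, E) 𝓘(ℝ, V) f x := by
  rw [mdifferentiableAt_iff]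
  refine ⟨?_, ?_⟩
  · have h1 := hf.continuousAt.comp (continuousAt_extChartAt (I := 𝓘(ℝ, E)) x)
    refine h1.congr ?_
    filter_upwards [extChartAt_source_mem_nhds (I := 𝓘(ℝ, E)) x] with y hy
    rw [Function.comp_apply, (extChartAt 𝓘(ℝ, E) x).left_inv hy]
  · rw [ModelWithCorners.range_eq_univ, differentiableWithinAt_univ]
    exact hf

/-- No differentiability is needed: without it, both derivatives take the default value zero. -/
theorem mfderiv_eq_fderiv_extChartAt {M : Type*} [TopologicalSpace M] [ChartedSpace E M]
    (f : M → V) (x : M) :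
    (mfderiv 𝓘(ℝ, E) 𝓘(ℝ, V) f x : E →L[ℝ] V) =
      fderiv ℝ (fun u ↦ f ((extChartAt 𝓘(ℝ, E) x).symm u)) (extChartAt 𝓘(ℝ, E) x x) := by
  by_cases h : MDifferentiableAt 𝓘(ℝ, E) 𝓘(ℝ, V) f x
  · rw [h.mfderiv]
    simp only [ModelWithCorners.range_eq_univ, fderivWithin_univ]
    rfl
  · rw [mfderiv_zero_of_not_mdifferentiableAt h, fderiv_zero_of_not_differentiableAt]
    · rfl
    intro hd
    exact h (mdifferentiableAt_of_extChartAt hd)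

theorem mfderiv_one_eq_derivOne (f : G → V) :
    (mfderiv 𝓘(ℝ, E) 𝓘(ℝ, V) f 1 : E →L[ℝ] V) = derivOne E f :=
  mfderiv_eq_fderiv_extChartAt f 1

theorem hasFDerivAt_extChartAt_one_symm {f : G → V}
    (hf : MDifferentiableAt 𝓘(ℝ, E) 𝓘(ℝ, V) f 1) :
    HasFDerivAt (fun u ↦ f ((extChartAt 𝓘(ℝ, E) (1 : G)).symm u)) (derivOne E f)
      (extChartAt 𝓘(ℝ, E) (1 : G) 1) := by
  have h := hf.differentiableWithinAt_writtenInExtChartAt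
  rw [ModelWithCorners.range_eq_univ, differentiableWithinAt_univ] at h
  exact DifferentiableAt.hasFDerivAt h

theorem hasMFDerivAt_one_of_extChartAt {f : G → V} {L : E →L[ℝ] V}
    (hf : HasFDerivAt (fun u ↦ f ((extChartAt 𝓘(ℝ, E) (1 : G)).symm u)) L
      (extChartAt 𝓘(ℝ, E) (1 : G) 1)) :
    HasMFDerivAt 𝓘(ℝ, E) 𝓘(ℝ, V) f 1 L := by
  have h1 := (mdifferentiableAt_of_extChartAt hf.differentiableAt).hasMFDerivAt
  have h2 : (mfderiv 𝓘(ℝ, E) 𝓘(ℝ, V) f 1 : E →L[ℝ] V) = L :=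
    (mfderiv_eq_fderiv_extChartAt f 1).trans hf.fderiv
  exact h2 ▸ h1

theorem tendsto_extChartAt_one_symm :
    Tendsto (extChartAt 𝓘(ℝ, E) (1 : G)).symm (𝓝 (extChartAt 𝓘(ℝ, E) (1 : G) 1)) (𝓝 (1 : G)) := by
  have := (continuousAt_extChartAt_symm (I := 𝓘(ℝ, E)) (1 : G)).tendsto
  rwa [(extChartAt 𝓘(ℝ, E) (1 : G)).left_inv (mem_extChartAt_source (1 : G))] at this

theorem derivOne_congr {f f' : G → V} (h : f =ᶠ[𝓝 1] f') : derivOne E f = derivOne E f' :=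
  EventuallyEq.fderiv_eq (tendsto_extChartAt_one_symm.eventually h)

theorem derivOne_extChartAt :
    derivOne E (fun g : G ↦ extChartAt 𝓘(ℝ, E) (1 : G) g) = ContinuousLinearMap.id ℝ E := by
  have : (fun u ↦ extChartAt 𝓘(ℝ, E) (1 : G) ((extChartAt 𝓘(ℝ, E) (1 : G)).symm u))
      =ᶠ[𝓝 (extChartAt 𝓘(ℝ, E) (1 : G) 1)] id := by
    filter_upwards [extChartAt_target_mem_nhds (I := 𝓘(ℝ, E)) (1 : G)] with u hu
    exact (extChartAt 𝓘(ℝ, E) (1 : G)).right_inv hu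
  rw [derivOne, this.fderiv_eq, fderiv_id]

variable [LieGroup 𝓘(ℝ, E) ∞ G]

theorem contDiffAt_uncurry_extChartAt_one_symm {f : G → G → V}
    (hf : ContMDiffAt (𝓘(ℝ, E).prod 𝓘(ℝ, E)) 𝓘(ℝ, V) ∞ (Function.uncurry f) (1, 1)) :
    ContDiffAt ℝ ∞ (Function.uncurry fun u v ↦ f ((extChartAt 𝓘(ℝ, E) (1 : G)).symm u)
        ((extChartAt 𝓘(ℝ, E) (1 : G)).symm v))
      (extChartAt 𝓘(ℝ, E) (1 : G) 1, extChartAt 𝓘(ℝ, E) (1 : G) 1) := by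
  have hs : ContMDiffAt 𝓘(ℝ, E) 𝓘(ℝ, E) ∞ (extChartAt 𝓘(ℝ, E) (1 : G)).symm
      (extChartAt 𝓘(ℝ, E) (1 : G) 1) :=
    (contMDiffOn_extChartAt_symm (1 : G)).contMDiffAt (extChartAt_target_mem_nhds (1 : G))
  have hl := (extChartAt 𝓘(ℝ, E) (1 : G)).left_inv (mem_extChartAt_source (1 : G))
  rw [← contMDiffAt_iff_contDiffAt, modelWithCornersSelf_prod, ← chartedSpaceSelf_prod]
  have h1 := hs.prodMap hs
  refine ContMDiffAt.comp (I' := 𝓘(ℝ, E).prod 𝓘(ℝ, E)) (g := Function.uncurry f) _ ?_ h1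
  rw [Prod.map_apply, hl]
  exact hf

theorem differentiableAt_derivOne_chart {f : G → G → V}
    (hf : ContMDiffAt (𝓘(ℝ, E).prod 𝓘(ℝ, E)) 𝓘(ℝ, V) ∞ (Function.uncurry f) (1, 1)) :
    DifferentiableAt ℝ (fun u ↦ derivOne E (f ((extChartAt 𝓘(ℝ, E) (1 : G)).symm u)))
      (extChartAt 𝓘(ℝ, E) (1 : G) 1) :=
  (ContDiffAt.fderiv (m := 1) (contDiffAt_uncurry_extChartAt_one_symm hf) contDiffAt_const
    (by norm_num; exact ENat.LEInfty.out)).differentiableAt (by simp)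

theorem derivOne_comm {f : G → G → V}
    (hf : ContMDiffAt (𝓘(ℝ, E).prod 𝓘(ℝ, E)) 𝓘(ℝ, V) ∞ (Function.uncurry f) (1, 1)) (X Y : E) :
    derivOne E (fun g : G ↦ derivOne E (f g) Y) X =
      derivOne E (fun h : G ↦ derivOne E (fun g ↦ f g h) X) Y :=
  fderiv_fderiv_comm ((contDiffAt_uncurry_extChartAt_one_symm hf).of_le
    (by exact ENat.LEInfty.out)) X Y

end DerivOne

/-! ### The derivative of the adjoint action. -/

section Adjoint

variable {E : Type*} [NormedAddCommGroup E] [NormedSpace ℝ E]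
  {G : Type*} [TopologicalSpace G] [ChartedSpace E G] [Group G] [LieGroup 𝓘(ℝ, E) ∞ G]
  {V : Type*} [NormedAddCommGroup V] [NormedSpace ℝ V]

theorem contMDiffAt_uncurry_mul {ψ : G → V} (hψ : ContMDiffAt 𝓘(ℝ, E) 𝓘(ℝ, V) ∞ ψ 1) :
    ContMDiffAt (𝓘(ℝ, E).prod 𝓘(ℝ, E)) 𝓘(ℝ, V) ∞
      (Function.uncurry fun g h : G ↦ ψ (g * h)) (1, 1) := by
  refine ContMDiffAt.comp (I' := 𝓘(ℝ, E)) (g := ψ) (f := fun p : G × G ↦ p.1 * p.2) _ ?_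
    (contMDiff_mul 𝓘(ℝ, E) ∞).contMDiffAt
  simpa using hψ

theorem contMDiffAt_uncurry_conj {ψ : G → V} (hψ : ContMDiffAt 𝓘(ℝ, E) 𝓘(ℝ, V) ∞ ψ 1) :
    ContMDiffAt (𝓘(ℝ, E).prod 𝓘(ℝ, E)) 𝓘(ℝ, V) ∞
      (Function.uncurry fun g h : G ↦ ψ (g⁻¹ * h * g⁻¹⁻¹)) (1, 1) := by
  have h1 : ContMDiff (𝓘(ℝ, E).prod 𝓘(ℝ, E)) 𝓘(ℝ, E) ∞ (fun p : G × G ↦ p.1⁻¹) :=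
    contMDiff_fst.inv
  have h2 : ContMDiff (𝓘(ℝ, E).prod 𝓘(ℝ, E)) 𝓘(ℝ, E) ∞
      (fun p : G × G ↦ p.1⁻¹ * p.2 * p.1⁻¹⁻¹) := (h1.mul contMDiff_snd).mul h1.inv
  refine ContMDiffAt.comp (I' := 𝓘(ℝ, E)) (g := ψ) _ ?_ h2.contMDiffAt
  simpa using hψ

theorem mdifferentiable_conj (g : G) :
    MDifferentiable 𝓘(ℝ, E) 𝓘(ℝ, E) (fun h : G ↦ g * h * g⁻¹) :=
  ((contMDiff_mul_right (I := 𝓘(ℝ, E)) (n := ∞) (a := g⁻¹)).comp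
    (contMDiff_mul_left (I := 𝓘(ℝ, E)) (n := ∞) (a := g))).mdifferentiable (by simp)

theorem derivOne_comp_conj {ψ : G → V} (hψ : MDifferentiableAt 𝓘(ℝ, E) 𝓘(ℝ, V) ψ 1) (g : G)
    (Y : GroupLieAlgebra 𝓘(ℝ, E) G) :
    derivOne E (fun h : G ↦ ψ (g * h * g⁻¹)) Y = derivOne E ψ (Ad E g Y) := by
  have h1 : g * 1 * g⁻¹ = (1 : G) := by simp
  have hψ' : MDifferentiableAt 𝓘(ℝ, E) 𝓘(ℝ, V) ψ (g * 1 * g⁻¹) := by rwa [h1]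
  rw [← mfderiv_one_eq_derivOne, ← mfderiv_one_eq_derivOne]
  have := mfderiv_comp (I' := 𝓘(ℝ, E)) (1 : G) hψ' (mdifferentiable_conj g (1 : G))
  -- The tangent spaces at `g * 1 * g⁻¹` and at `1` are both `E` by definition; only the base point
  -- has to be transported.
  have key : ∀ a : G, a = 1 → ∀ v : E,
      (mfderiv 𝓘(ℝ, E) 𝓘(ℝ, V) ψ a v : V) = (mfderiv 𝓘(ℝ, E) 𝓘(ℝ, V) ψ 1 v : V) := by
    rintro a rfl v; rfl
  refine Eq.trans ?_ (key _ h1 _)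
  exact DFunLike.congr_fun this Y

theorem contMDiffAt_extChartAt_one :
    ContMDiffAt 𝓘(ℝ, E) 𝓘(ℝ, E) ∞ (fun g : G ↦ extChartAt 𝓘(ℝ, E) (1 : G) g) 1 :=
  contMDiffAt_extChartAt

/-- The map `g ↦ Ad_{g⁻¹} Y`, with values in the model space. -/
def adInv (Y : E) (g : G) : E := (Ad E g⁻¹ : GroupLieAlgebra 𝓘(ℝ, E) G →ₗ[ℝ] _) Y

/-- The chart has derivative the identity at `1`, so composing with it presents `Ad_{g⁻¹} Y` as a
partial derivative of a smooth function of two variables, whence its differentiability in `g`. -/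
theorem adInv_eq_derivOne (Y : E) (g : G) :
    adInv Y g =
      derivOne E (fun h : G ↦ extChartAt 𝓘(ℝ, E) (1 : G) (g⁻¹ * h * g⁻¹⁻¹)) Y := by
  have := derivOne_comp_conj (contMDiffAt_extChartAt_one.mdifferentiableAt (by simp)) g⁻¹ Y
  rw [this, derivOne_extChartAt]
  rfl

theorem adInv_one (Y : E) : adInv Y (1 : G) = Y := by
  rw [adInv, inv_one, Ad_one]; rfl

theorem differentiableAt_adInv_chart (Y : E) :
    DifferentiableAt ℝ (fun u ↦ adInv Y ((extChartAt 𝓘(ℝ, E) (1 : G)).symm u))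
      (extChartAt 𝓘(ℝ, E) (1 : G) 1) := by
  simp_rw [adInv_eq_derivOne]
  exact (differentiableAt_derivOne_chart
    (contMDiffAt_uncurry_conj contMDiffAt_extChartAt_one)).clm_apply (differentiableAt_const _)

theorem mdifferentiableAt_adInv_one (Y : E) :
    MDifferentiableAt 𝓘(ℝ, E) 𝓘(ℝ, E) (adInv Y : G → E) 1 :=
  mdifferentiableAt_of_extChartAt (differentiableAt_adInv_chart Y)

/-- Differentiating `ψ (h g) = ψ (g (g⁻¹ h g))` in `h` and then in `g`. -/
theorem derivOne_mul_swap {ψ : G → V} (hψ : ContMDiffAt 𝓘(ℝ, E) 𝓘(ℝ, V) ∞ ψ 1)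
    (X Y : E) :
    derivOne E (fun g : G ↦ derivOne E (fun h : G ↦ ψ (h * g)) Y) X =
      derivOne E ψ (derivOne E (adInv Y : G → E) X) +
        derivOne E (fun g : G ↦ derivOne E (fun h : G ↦ ψ (g * h)) Y) X := by
  have hL := differentiableAt_derivOne_chart (contMDiffAt_uncurry_mul hψ)
  have hA := differentiableAt_adInv_chart (G := G) Y
  have hev : (fun g : G ↦ derivOne E (fun h : G ↦ ψ (h * g)) Y) =ᶠ[𝓝 1]
      fun g ↦ derivOne E (fun h : G ↦ ψ (g * h)) (adInv Y g) := by
    -- Smoothness at a point need not provide one neighbourhood for all orders, so only order `1` is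
    -- spread to nearby points.
    have := (contMDiffAt_iff_contMDiffAt_nhds (by simp)).1
      (hψ.of_le (n := ∞) (m := 1) ENat.LEInfty.out)
    filter_upwards [this] with g hg
    have hd : MDifferentiableAt 𝓘(ℝ, E) 𝓘(ℝ, V) (fun h ↦ ψ (g * h)) 1 := by
      refine MDifferentiableAt.comp (I' := 𝓘(ℝ, E)) (g := ψ) (f := fun h ↦ g * h) 1 ?_
        ((contMDiff_mul_left (I := 𝓘(ℝ, E)) (n := ∞) (a := g)).mdifferentiable (by simp) _)
      rw [mul_one]
      exact hg.mdifferentiableAt (by simp)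
    have h2 := derivOne_comp_conj hd g⁻¹ Y
    rw [adInv, ← h2]
    congr 2
    ext h
    simp [mul_assoc]
  rw [derivOne_congr hev]
  -- Product rule for a `g`-dependent linear form applied to `Ad_{g⁻¹} Y`; `h4` is the same with `Y`
  -- frozen, so the two differ by the term in which `Ad_{g⁻¹} Y` is differentiated.
  have h3 := hL.hasFDerivAt.clm_apply hA.hasFDerivAt
  have h4 := hL.hasFDerivAt.clm_apply (hasFDerivAt_const Y _)
  have h0 : (extChartAt 𝓘(ℝ, E) (1 : G)).symm (extChartAt 𝓘(ℝ, E) (1 : G) 1) = 1 :=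
    (extChartAt 𝓘(ℝ, E) (1 : G)).left_inv (mem_extChartAt_source (1 : G))
  conv_lhs => rw [derivOne]
  rw [h3.fderiv]
  conv_rhs => enter [2]; rw [derivOne]
  rw [h4.fderiv]
  simp only [h0, adInv_one, one_mul]
  simp [derivOne]

end Adjoint

/-! ### The Lie bracket as a second derivative of the multiplication. -/

section Bracket

variable {E : Type*} [NormedAddCommGroup E] [NormedSpace ℝ E]
  {G : Type*} [TopologicalSpace G] [ChartedSpace E G] [Group G] [LieGroup 𝓘(ℝ, E) ∞ G]
  {V : Type*} [NormedAddCommGroup V] [NormedSpace ℝ V]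

/-- The left-invariant vector field of `X`, read in the chart at `1`. -/
theorem mpullbackWithin_mulInvariantVectorField_eventuallyEq (X : E) :
    VectorField.mpullbackWithin 𝓘(ℝ, E) 𝓘(ℝ, E) (extChartAt 𝓘(ℝ, E) (1 : G)).symm
      (mulInvariantVectorField (I := 𝓘(ℝ, E)) (G := G) X) (Set.range 𝓘(ℝ, E))
      =ᶠ[𝓝 (extChartAt 𝓘(ℝ, E) (1 : G) 1)]
    fun u ↦ (derivOne E (fun h : G ↦ extChartAt 𝓘(ℝ, E) (1 : G)
      ((extChartAt 𝓘(ℝ, E) (1 : G)).symm u * h)) X : E) := by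
  have : IsManifold 𝓘(ℝ, E) 1 G := IsManifold.of_le (n := ∞) ENat.LEInfty.out
  filter_upwards [extChartAt_target_mem_nhds (I := 𝓘(ℝ, E)) (1 : G)] with u hu
  have hg : (extChartAt 𝓘(ℝ, E) (1 : G)).symm u ∈ (chartAt E (1 : G)).source := by
    rw [← extChartAt_source (I := 𝓘(ℝ, E))]
    exact (extChartAt 𝓘(ℝ, E) (1 : G)).map_target hu
  have hinv : (mfderivWithin 𝓘(ℝ, E) 𝓘(ℝ, E) (extChartAt 𝓘(ℝ, E) (1 : G)).symm
      (Set.range 𝓘(ℝ, E)) u).inverse = mfderiv 𝓘(ℝ, E) 𝓘(ℝ, E) (extChartAt 𝓘(ℝ, E) (1 : G))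
        ((extChartAt 𝓘(ℝ, E) (1 : G)).symm u) :=
    ContinuousLinearMap.inverse_eq
      (mfderivWithin_extChartAt_symm_comp_mfderiv_extChartAt hu)
      (mfderiv_extChartAt_comp_mfderivWithin_extChartAt_symm hu)
  rw [VectorField.mpullbackWithin_apply, hinv, ← mfderiv_one_eq_derivOne]
  set g := (extChartAt 𝓘(ℝ, E) (1 : G)).symm u
  have hg' : MDifferentiableAt 𝓘(ℝ, E) 𝓘(ℝ, E) (extChartAt 𝓘(ℝ, E) (1 : G)) (g * 1) := by
    rw [mul_one]; exact mdifferentiableAt_extChartAt hg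
  have := mfderiv_comp (I' := 𝓘(ℝ, E)) (1 : G) hg'
    ((contMDiff_mul_left (I := 𝓘(ℝ, E)) (n := ∞) (a := g)).mdifferentiable (by simp) (1 : G))
  refine Eq.trans ?_ (DFunLike.congr_fun this X).symm
  have key : ∀ a : G, a = g → ∀ v : E,
      (mfderiv 𝓘(ℝ, E) 𝓘(ℝ, E) (extChartAt 𝓘(ℝ, E) (1 : G)) g v : E) =
        (mfderiv 𝓘(ℝ, E) 𝓘(ℝ, E) (extChartAt 𝓘(ℝ, E) (1 : G)) a v : E) := by
    rintro a rfl v; rfl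
  exact key _ (mul_one g) _

theorem lieBracketWithin_eq_of_eventuallyEq {A B A' B' : E → E} {s : Set E} {u : E}
    (hA : A =ᶠ[𝓝 u] A') (hB : B =ᶠ[𝓝 u] B') (hs : s = Set.univ) :
    VectorField.lieBracketWithin ℝ A B s u =
      fderiv ℝ B' u (A' u) - fderiv ℝ A' u (B' u) := by
  rw [hs, VectorField.lieBracketWithin_univ, hA.lieBracket_vectorField_eq hB,
    VectorField.lieBracket_eq]

/-- The Lie bracket of `𝔤` in terms of second derivatives of the multiplication. -/
theorem derivOne_sub_eq_lie (X Y : GroupLieAlgebra 𝓘(ℝ, E) G) :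
      derivOne E (fun g : G ↦
        derivOne E (fun h : G ↦ extChartAt 𝓘(ℝ, E) (1 : G) (g * h)) Y) X -
      derivOne E (fun g : G ↦
        derivOne E (fun h : G ↦ extChartAt 𝓘(ℝ, E) (1 : G) (g * h)) X) Y =
        (⁅X, Y⁆ : GroupLieAlgebra 𝓘(ℝ, E) G) := by
  have h0 : (extChartAt 𝓘(ℝ, E) (1 : G)).symm (extChartAt 𝓘(ℝ, E) (1 : G) 1) = 1 :=
    (extChartAt 𝓘(ℝ, E) (1 : G)).left_inv (mem_extChartAt_source (1 : G))
  -- The chart's own derivative at its base point is the identity, so the outer inverse in the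
  -- manifold bracket disappears.
  have hid : ∀ v : E, ((mfderiv 𝓘(ℝ, E) 𝓘(ℝ, E) (extChartAt 𝓘(ℝ, E) (1 : G)) 1).inverse v : E) =
      v := by
    have h1 : (mfderiv 𝓘(ℝ, E) 𝓘(ℝ, E) (extChartAt 𝓘(ℝ, E) (1 : G)) 1 : E →L[ℝ] E) =
        ContinuousLinearMap.id ℝ E := by
      rw [← derivOne_extChartAt (G := G), ← mfderiv_one_eq_derivOne]
    exact DFunLike.congr_fun
      ((congrArg ContinuousLinearMap.inverse h1).trans ContinuousLinearMap.inverse_id)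
  symm
  rw [GroupLieAlgebra.bracket_def, ← VectorField.mlieBracketWithin_univ,
    VectorField.mlieBracketWithin_apply]
  refine (hid _).trans ?_
  refine (lieBracketWithin_eq_of_eventuallyEq (E := E)
    (mpullbackWithin_mulInvariantVectorField_eventuallyEq (E := E) (G := G) X)
    (mpullbackWithin_mulInvariantVectorField_eventuallyEq (E := E) (G := G) Y) (by simp)).trans ?_
  simp only [h0, one_mul, derivOne_extChartAt]
  rfl

/-- Take the chart for `ψ` in `derivOne_mul_swap`. Symmetry of mixed partials turns the left side
into the second derivative of `g * h` with `X` and `Y` interchanged; what remains is the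
antisymmetrised second derivative, which is the bracket. -/
theorem derivOne_adInv (X Y : GroupLieAlgebra 𝓘(ℝ, E) G) :
    derivOne E (adInv Y : G → E) X = (-⁅X, Y⁆ : GroupLieAlgebra 𝓘(ℝ, E) G) := by
  have h1 := derivOne_mul_swap (contMDiffAt_extChartAt_one (E := E) (G := G)) X Y
  have h2 := derivOne_comm (contMDiffAt_uncurry_mul (contMDiffAt_extChartAt_one (E := E) (G := G)))
    Y X
  rw [derivOne_extChartAt, ContinuousLinearMap.id_apply] at h1
  obtain ⟨W, hW⟩ : ∃ W : E, W = (⁅X, Y⁆ : GroupLieAlgebra 𝓘(ℝ, E) G) := ⟨_, rfl⟩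
  have h3 := (derivOne_sub_eq_lie X Y).trans hW.symm
  refine Eq.trans ?_ (congrArg (fun Z : E ↦ -Z) hW)
  rw [← h3, h2, h1]
  abel

end Bracket

/-! ### Continuity of the adjoint action and its compatibility with brackets. -/

section AdjointHom

variable {E : Type*} [NormedAddCommGroup E] [NormedSpace ℝ E]
  {G : Type*} [TopologicalSpace G] [ChartedSpace E G] [Group G] [LieGroup 𝓘(ℝ, E) ∞ G]
  {V : Type*} [NormedAddCommGroup V] [NormedSpace ℝ V]

variable (E) in
/-- `Ad_g` as a continuous linear map of the model space. -/
def adCLM (g : G) : E →L[ℝ] E := mfderiv 𝓘(ℝ, E) 𝓘(ℝ, E) (fun h : G ↦ g * h * g⁻¹) 1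

theorem adInv_mul (g h : G) (Y : E) : adInv Y (g * h) = adCLM E h⁻¹ (adInv Y g) := by
  have := DFunLike.congr_fun (Ad_mul (E := E) h⁻¹ g⁻¹) Y
  rw [← mul_inv_rev] at this
  exact this

/-- Multiplicativity of `Ad` moves continuity from `1` to every point. -/
theorem continuous_adInv (Y : E) : Continuous (adInv Y : G → E) := by
  have : IsTopologicalGroup G := topologicalGroup_of_lieGroup 𝓘(ℝ, E) ∞
  rw [continuous_iff_continuousAt]
  intro g
  have h1 : (adInv Y : G → E) = fun k ↦ adCLM E g⁻¹ (adInv Y (k * g⁻¹)) := by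
    ext k
    rw [← adInv_mul]
    simp
  rw [h1]
  refine (adCLM E g⁻¹).continuous.continuousAt.comp ?_
  refine ContinuousAt.comp (g := (adInv Y : G → E)) ?_ (by fun_prop)
  rw [mul_inv_cancel]
  exact (mdifferentiableAt_adInv_one Y).continuousAt

theorem derivOne_clm_comp {W : Type*} [NormedAddCommGroup W] [NormedSpace ℝ W] {f : G → V}
    (hf : MDifferentiableAt 𝓘(ℝ, E) 𝓘(ℝ, V) f 1) (L : V →L[ℝ] W) (X : E) :
    derivOne E (fun g ↦ L (f g)) X = L (derivOne E f X) := by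
  have h2 := L.hasFDerivAt.comp _ (hasFDerivAt_extChartAt_one_symm hf)
  exact DFunLike.congr_fun (HasFDerivAt.fderiv h2) X

/-- `Ad_g` is a Lie algebra homomorphism. -/
theorem Ad_lie (g : G) (X Y : GroupLieAlgebra 𝓘(ℝ, E) G) :
    Ad E g ⁅X, Y⁆ = ⁅Ad E g X, Ad E g Y⁆ := by
  -- The identity `Ad_g Ad_{h⁻¹} = Ad_{(g h g⁻¹)⁻¹} Ad_g`, to be differentiated in `h` at `1`.
  have h1 : (fun h : G ↦ adCLM E g (adInv Y h)) =
      fun h : G ↦ adInv (E := E) (Ad E g Y) (g * h * g⁻¹) := by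
    ext h
    have e1 := DFunLike.congr_fun (Ad_mul (E := E) g h⁻¹) Y
    have e2 := DFunLike.congr_fun (Ad_mul (E := E) (g * h * g⁻¹)⁻¹ g) Y
    have e3 : (g * h * g⁻¹)⁻¹ * g = g * h⁻¹ := by group
    rw [e3] at e2
    exact e1.symm.trans e2
  have h2 := derivOne_clm_comp (mdifferentiableAt_adInv_one (E := E) (G := G) Y) (adCLM E g) X
  have h3 := derivOne_comp_conj (mdifferentiableAt_adInv_one (E := E) (G := G) (Ad E g Y)) g X
  rw [h1, h3] at h2
  have h4 := derivOne_adInv (E := E) (G := G) (Ad E g X) (Ad E g Y)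
  have h5 := derivOne_adInv (E := E) (G := G) X Y
  have h6 : (-⁅Ad E g X, Ad E g Y⁆ : GroupLieAlgebra 𝓘(ℝ, E) G) = Ad E g (-⁅X, Y⁆) :=
    h4.symm.trans (h2.trans (congrArg (adCLM E g) h5))
  rw [map_neg] at h6
  exact (neg_injective h6).symm

end AdjointHom

/-! ### Functions with vanishing differential. -/

section LocallyConstant

variable {E : Type*} [NormedAddCommGroup E] [NormedSpace ℝ E]
  {M : Type*} [TopologicalSpace M] [ChartedSpace E M] [IsManifold 𝓘(ℝ, E) ∞ M]
  {V : Type*} [NormedAddCommGroup V] [NormedSpace ℝ V]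

theorem eventually_eq_of_mfderiv_eq_zero {f : M → V} {s : Set M} (hs : IsOpen s)
    (hf : ∀ x ∈ s, HasMFDerivAt 𝓘(ℝ, E) 𝓘(ℝ, V) f x 0) {x : M} (hx : x ∈ s) :
    ∀ᶠ y in 𝓝 x, f y = f x := by
  have : IsManifold 𝓘(ℝ, E) 1 M := IsManifold.of_le (n := ∞) ENat.LEInfty.out
  set φ := extChartAt 𝓘(ℝ, E) x
  have hT : φ.target ∩ φ.symm ⁻¹' s ∈ 𝓝 (φ x) := by
    refine inter_mem (extChartAt_target_mem_nhds x) ?_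
    refine (continuousAt_extChartAt_symm (I := 𝓘(ℝ, E)) x).preimage_mem_nhds ?_
    rw [extChartAt_to_inv]
    exact hs.mem_nhds hx
  obtain ⟨r, hr, hball⟩ := Metric.mem_nhds_iff.1 hT
  have hder : ∀ u ∈ Metric.ball (φ x) r, HasFDerivAt (fun u ↦ f (φ.symm u)) (0 : E →L[ℝ] V) u := by
    intro u hu
    obtain ⟨hu1, hu2⟩ := hball hu
    have h1 : MDifferentiableAt 𝓘(ℝ, E) 𝓘(ℝ, E) φ.symm u := by
      have := mdifferentiableWithinAt_extChartAt_symm (I := 𝓘(ℝ, E)) hu1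
      rwa [ModelWithCorners.range_eq_univ, mdifferentiableWithinAt_univ] at this
    have h2 := (hf _ hu2).comp u h1.hasMFDerivAt
    rw [ContinuousLinearMap.zero_comp] at h2
    exact h2.hasFDerivAt
  have hconst : ∀ u ∈ Metric.ball (φ x) r, f (φ.symm u) = f (φ.symm (φ x)) := by
    intro u hu
    exact (convex_ball (φ x) r).is_const_of_fderivWithin_eq_zero (𝕜 := ℝ)
      (fun v hv ↦ (hder v hv).differentiableAt.differentiableWithinAt)
      (fun v hv ↦ ((hder v hv).hasFDerivWithinAt.fderivWithin
        (Metric.isOpen_ball.uniqueDiffWithinAt hv))) hu (Metric.mem_ball_self hr)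
  have hc := continuousAt_extChartAt (I := 𝓘(ℝ, E)) x
  filter_upwards [hc.preimage_mem_nhds (Metric.ball_mem_nhds (φ x) hr),
    extChartAt_source_mem_nhds (I := 𝓘(ℝ, E)) x] with y hy hys
  have := hconst _ hy
  rwa [φ.left_inv hys, extChartAt_to_inv] at this

/-- A function with vanishing differential on an open preconnected set is constant there. -/
theorem eq_of_mfderiv_eq_zero {f : M → V} {s : Set M} (hs : IsOpen s) (hs' : IsPreconnected s)
    (hf : ∀ x ∈ s, HasMFDerivAt 𝓘(ℝ, E) 𝓘(ℝ, V) f x 0) {x y : M} (hx : x ∈ s) (hy : y ∈ s) :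
    f x = f y := by
  have : PreconnectedSpace s := isPreconnected_iff_preconnectedSpace.1 hs'
  have hl : IsLocallyConstant (fun z : s ↦ f z) := by
    rw [IsLocallyConstant.iff_eventually_eq]
    intro z
    exact continuous_subtype_val.continuousAt.eventually
      (eventually_eq_of_mfderiv_eq_zero hs hf z.2)
  exact hl.apply_eq_of_preconnectedSpace ⟨x, hx⟩ ⟨y, hy⟩

end LocallyConstant

/-! ### Formal consequences of the Poisson axioms. -/

section PoissonAlgebra

variable {F : Type*} [NormedAddCommGroup F] [NormedSpace ℝ F]
  {P : Type*} [TopologicalSpace P] [ChartedSpace F P] (π : PoissonStructure F P)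

theorem PoissonStructure.skew (f h : Smooth F P) : π.bracket f h = -π.bracket h f := by
  have := π.alternating (f + h)
  simp only [map_add, LinearMap.add_apply, π.alternating, zero_add, add_zero] at this
  exact eq_neg_of_add_eq_zero_right this

theorem bracket_casimir_right {c : Smooth F P} (hc : c ∈ Casimir π) (f : Smooth F P) :
    π.bracket f c = 0 := by
  rw [π.skew, hc f, neg_zero]

theorem mem_casimir_of_bracket_right {c : Smooth F P} (hc : ∀ f, π.bracket f c = 0) :
    c ∈ Casimir π := by
  intro f
  rw [π.skew, hc f, neg_zero]

/-- The Jacobi identity read as a commutator of the operators `{·, h}` and `{·, k}`. -/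
theorem PoissonStructure.bracket_bracket_right (f h k : Smooth F P) :
    π.bracket f (π.bracket h k) =
      π.bracket (π.bracket f h) k - π.bracket (π.bracket f k) h := by
  have h1 := π.jacobi f h k
  rw [π.skew k f, map_neg, π.skew h (π.bracket f k), π.skew k (π.bracket f h), neg_neg] at h1
  rw [eq_sub_iff_add_eq, ← sub_eq_zero, ← h1]
  abel

end PoissonAlgebra

/-! ### The defect of a momentum map and its derivative. -/

section MomentumMap

variable {E : Type*} [NormedAddCommGroup E] [NormedSpace ℝ E]
  {F : Type*} [NormedAddCommGroup F] [NormedSpace ℝ F]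
  {G : Type*} [TopologicalSpace G] [ChartedSpace E G] [Group G]
  {P : Type*} [TopologicalSpace P] [ChartedSpace F P] [MulAction G P]

theorem infinitesimalAction_eq_derivOne (X : GroupLieAlgebra 𝓘(ℝ, E) G) (f : Smooth F P) (x : P) :
    infinitesimalAction X f x = derivOne E (fun g : G ↦ f (g • x)) X :=
  DFunLike.congr_fun (mfderiv_one_eq_derivOne (fun g : G ↦ f (g • x))) X

/-- The components of a map to `𝔤*`, as a linear map. -/
def SmoothMapToDual.componentLinear (m : SmoothMapToDual E F G P) :
    GroupLieAlgebra 𝓘(ℝ, E) G →ₗ[ℝ] Smooth F P where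
  toFun := m.component
  map_add' X Y := by ext x; exact map_add (m.toFun x) X Y
  map_smul' t X := by ext x; exact map_smul (m.toFun x) t X

theorem SmoothMapToDual.component_neg (m : SmoothMapToDual E F G P)
    (X : GroupLieAlgebra 𝓘(ℝ, E) G) : m.component (-X) = -m.component X :=
  map_neg m.componentLinear X

variable [ContMDiffSMul 𝓘(ℝ, E) 𝓘(ℝ, F) ∞ G P]

theorem contMDiff_orbit (f : Smooth F P) (x : P) :
    ContMDiff 𝓘(ℝ, E) 𝓘(ℝ, ℝ) ∞ (fun g : G ↦ f (g • x)) :=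
  f.contMDiff.comp
    ((contMDiff_smul (I := 𝓘(ℝ, E)) (I' := 𝓘(ℝ, F)) (n := ∞) (G := G) (M := P)).comp
      (contMDiff_id.prodMk contMDiff_const))

theorem translate_apply (g : G) (f : Smooth F P) (x : P) : translate E g f x = f (g • x) := rfl

theorem translate_translate_inv (g : G) (f : Smooth F P) :
    translate E g (translate E g⁻¹ f) = f := by
  ext x
  simp [translate_apply]

variable [LieGroup 𝓘(ℝ, E) ∞ G]

/-- Infinitesimal form of `g⁻¹ h g x = (g⁻¹ h g) x`, differentiated in `h` at `1`. -/
theorem infinitesimalAction_translate_inv (g : G) (Y : GroupLieAlgebra 𝓘(ℝ, E) G) (f : Smooth F P)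
    (x : P) :
    infinitesimalAction Y (translate E g⁻¹ f) (g • x) =
      infinitesimalAction (Ad E g⁻¹ Y) f x := by
  rw [infinitesimalAction_eq_derivOne, infinitesimalAction_eq_derivOne]
  rw [← derivOne_comp_conj ((contMDiff_orbit f x).mdifferentiable (by simp) 1)]
  congr 2
  ext h
  simp [translate_apply, mul_smul]

variable {π : PoissonStructure F P} {m : SmoothMapToDual E F G P}

/-- Carrying the field `λ(Y)` along `σ_g` gives `λ(Ad_{g⁻¹} Y)`; as `σ_g` preserves the bracket, it
also gives the Hamiltonian field of `m(Y) ∘ σ_g`. -/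
theorem IsMomentumMap.bracket_translate (hPoisson : IsPoissonAction E G π)
    (hm : IsMomentumMap π m) (g : G) (Y : GroupLieAlgebra 𝓘(ℝ, E) G) (f : Smooth F P) :
    π.bracket f (translate E g (m.component Y)) = π.bracket f (m.component (Ad E g⁻¹ Y)) := by
  ext x
  rw [← hm, ← infinitesimalAction_translate_inv, hm, ← translate_apply (E := E), ← hPoisson,
    translate_translate_inv]

/-- The component at `Y` of the defect of `m` at `g`, as a Casimir function. -/
def casimirDefect (hPoisson : IsPoissonAction E G π) (hm : IsMomentumMap π m) (g : G) :
    GroupLieAlgebra 𝓘(ℝ, E) G →ₗ[ℝ] Casimir π where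
  toFun Y := ⟨translate E g (m.component Y) - m.component (Ad E g⁻¹ Y),
    mem_casimir_of_bracket_right π fun f ↦ by
      rw [map_sub, hm.bracket_translate hPoisson, sub_self]⟩
  map_add' X Y := by
    ext x
    change m.toFun (g • x) (X + Y) - m.toFun x (Ad E g⁻¹ (X + Y)) =
      (m.toFun (g • x) X - m.toFun x (Ad E g⁻¹ X)) + (m.toFun (g • x) Y - m.toFun x (Ad E g⁻¹ Y))
    simp only [map_add]
    ring
  map_smul' t X := by
    ext x
    change m.toFun (g • x) (t • X) - m.toFun x (Ad E g⁻¹ (t • X)) =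
      t * (m.toFun (g • x) X - m.toFun x (Ad E g⁻¹ X))
    simp only [map_smul, smul_eq_mul]
    ring

theorem casimirDefect_apply (hPoisson : IsPoissonAction E G π) (hm : IsMomentumMap π m) (g : G)
    (Y : GroupLieAlgebra 𝓘(ℝ, E) G) (x : P) :
    (casimirDefect hPoisson hm g Y).1 x = m.defect g x Y := rfl

variable [CompleteSpace E]

/-- Apply `derivOne_mul_swap` to `g ↦ f(g x)`: the second derivatives in the two orders are `{{f,
m(Y)}, m(X)}` and `{{f, m(X)}, m(Y)}`, and the correction term is `-{f, m([X, Y])}`. -/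
theorem IsMomentumMap.bracket_component_lie (hm : IsMomentumMap π m)
    (X Y : GroupLieAlgebra 𝓘(ℝ, E) G) (f : Smooth F P) :
    π.bracket f (m.component ⁅X, Y⁆) = π.bracket f (π.bracket (m.component X) (m.component Y)) := by
  ext x
  have hψ := (contMDiff_orbit (E := E) (G := G) f x).contMDiffAt (x := 1)
  have h1 := derivOne_mul_swap hψ X Y
  have h2 := derivOne_comm (contMDiffAt_uncurry_mul hψ) X Y
  have key : ∀ (Z : GroupLieAlgebra 𝓘(ℝ, E) G) (g : G),
      derivOne E (fun h : G ↦ f ((h * g) • x)) Z = π.bracket f (m.component Z) (g • x) := by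
    intro Z g
    rw [← hm, infinitesimalAction_eq_derivOne]
    simp only [mul_smul]
  simp only [key] at h1 h2
  have e1 := derivOne_adInv (E := E) (G := G) X Y
  have e2 : derivOne E (fun g : G ↦ f (g • x)) (derivOne E (adInv Y : G → E) X) =
      -π.bracket f (m.component ⁅X, Y⁆) x := by
    rw [e1]
    refine (infinitesimalAction_eq_derivOne _ f x).symm.trans ?_
    rw [hm, m.component_neg, map_neg]
    rfl
  rw [h2, e2] at h1
  rw [← infinitesimalAction_eq_derivOne, ← infinitesimalAction_eq_derivOne, hm, hm] at h1
  rw [π.bracket_bracket_right]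
  change _ = (_ - _ : ℝ)
  linarith

/-- `m([X, Y]) - {m(X), m(Y)}` is a Casimir function. -/
theorem IsMomentumMap.lie_sub_bracket_mem_casimir (hm : IsMomentumMap π m)
    (X Y : GroupLieAlgebra 𝓘(ℝ, E) G) :
    m.component ⁅X, Y⁆ - π.bracket (m.component X) (m.component Y) ∈ Casimir π :=
  mem_casimir_of_bracket_right π fun f ↦ by
    rw [map_sub, hm.bracket_component_lie, sub_self]

/-- The bilinear map `Γ_{X, Y} = m([X, Y]) - {m(X), m(Y)}` with values in `Car(P)`. -/
def casimirCocycle (hm : IsMomentumMap π m) :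
    GroupLieAlgebra 𝓘(ℝ, E) G →ₗ[ℝ] GroupLieAlgebra 𝓘(ℝ, E) G →ₗ[ℝ] Casimir π :=
  LinearMap.mk₂ ℝ (fun X Y ↦ ⟨_, hm.lie_sub_bracket_mem_casimir X Y⟩)
    (fun X X' Y ↦ Subtype.ext <| by
      change m.componentLinear ⁅X + X', Y⁆ - π.bracket (m.componentLinear (X + X'))
        (m.componentLinear Y) = (m.componentLinear ⁅X, Y⁆ - π.bracket (m.componentLinear X)
        (m.componentLinear Y)) + (m.componentLinear ⁅X', Y⁆ - π.bracket (m.componentLinear X')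
        (m.componentLinear Y))
      rw [add_lie, map_add, map_add, map_add, LinearMap.add_apply]
      abel)
    (fun t X Y ↦ Subtype.ext <| by
      change m.componentLinear ⁅t • X, Y⁆ - π.bracket (m.componentLinear (t • X))
        (m.componentLinear Y) = t • (m.componentLinear ⁅X, Y⁆ - π.bracket (m.componentLinear X)
        (m.componentLinear Y))
      rw [smul_lie, map_smul, map_smul, map_smul, LinearMap.smul_apply, smul_sub])
    (fun X Y Y' ↦ Subtype.ext <| by
      change m.componentLinear ⁅X, Y + Y'⁆ - π.bracket (m.componentLinear X)
        (m.componentLinear (Y + Y')) = (m.componentLinear ⁅X, Y⁆ - π.bracket (m.componentLinear X)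
        (m.componentLinear Y)) + (m.componentLinear ⁅X, Y'⁆ - π.bracket (m.componentLinear X)
        (m.componentLinear Y'))
      rw [lie_add, map_add, map_add, map_add]
      abel)
    (fun t X Y ↦ Subtype.ext <| by
      change m.componentLinear ⁅X, t • Y⁆ - π.bracket (m.componentLinear X)
        (m.componentLinear (t • Y)) = t • (m.componentLinear ⁅X, Y⁆ - π.bracket (m.componentLinear X)
        (m.componentLinear Y))
      rw [lie_smul, map_smul, map_smul, map_smul, smul_sub])

theorem casimirCocycle_coe (hm : IsMomentumMap π m) (X Y : GroupLieAlgebra 𝓘(ℝ, E) G) :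
    (casimirCocycle hm X Y : Smooth F P) =
      m.component ⁅X, Y⁆ - π.bracket (m.component X) (m.component Y) := rfl

theorem casimirCocycle_self (hm : IsMomentumMap π m) (X : GroupLieAlgebra 𝓘(ℝ, E) G) :
    casimirCocycle hm X X = 0 := by
  apply Subtype.ext
  rw [casimirCocycle_coe, lie_self, π.alternating, sub_zero]
  exact map_zero m.componentLinear

theorem casimirCocycle_cocycle (hm : IsMomentumMap π m) (X Y Z : GroupLieAlgebra 𝓘(ℝ, E) G) :
    casimirCocycle hm X ⁅Y, Z⁆ =
      casimirCocycle hm ⁅X, Y⁆ Z + casimirCocycle hm Y ⁅X, Z⁆ := by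
  apply Subtype.ext
  rw [Submodule.coe_add, casimirCocycle_coe, casimirCocycle_coe, casimirCocycle_coe,
    hm.bracket_component_lie, hm.bracket_component_lie, π.skew (m.component ⁅X, Y⁆),
    hm.bracket_component_lie, leibniz_lie X Y Z]
  have h1 : m.component (⁅⁅X, Y⁆, Z⁆ + ⁅Y, ⁅X, Z⁆⁆) =
    m.component ⁅⁅X, Y⁆, Z⁆ + m.component ⁅Y, ⁅X, Z⁆⁆ := map_add m.componentLinear _ _
  have h2 := π.jacobi (m.component X) (m.component Y) (m.component Z)
  rw [π.skew (m.component Z) (m.component X), map_neg] at h2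
  rw [h1, ← sub_eq_zero, ← h2, ← sub_eq_zero]
  -- The Jacobi sum occurs twice, once in the cocycle identity and once in place of the zero
  -- rewritten by `h2`; hence the factor `-2`.
  have h3 : ∀ a b c d e : Smooth F P, a + b - c - (a - -d + (b - e)) - (c + -e + d) =
    -(2 : ℝ) • (c + -e + d) := by
    intro a b c d e
    module
  rw [h3, h2, smul_zero]

/-- The value of `m` at a point, as a continuous linear form on the model space. -/
def SmoothMapToDual.toCLM [FiniteDimensional ℝ E] (m : SmoothMapToDual E F G P) (x : P) :
    E →L[ℝ] ℝ :=
  LinearMap.toContinuousLinearMap (show E →ₗ[ℝ] ℝ from m.toFun x)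

theorem mdifferentiableAt_toCLM_adInv [FiniteDimensional ℝ E] (m : SmoothMapToDual E F G P)
    (x : P) (Y : E) :
    MDifferentiableAt 𝓘(ℝ, E) 𝓘(ℝ, ℝ) (fun g : G ↦ m.toCLM x (adInv Y g)) 1 :=
  ((m.toCLM x).mdifferentiableAt).comp 1 (mdifferentiableAt_adInv_one Y)

theorem mdifferentiableAt_defect [FiniteDimensional ℝ E] (m : SmoothMapToDual E F G P)
    (x : P) (Y : GroupLieAlgebra 𝓘(ℝ, E) G) :
    MDifferentiableAt 𝓘(ℝ, E) 𝓘(ℝ, ℝ) (fun g : G ↦ m.defect g x Y) 1 :=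
  ((contMDiff_orbit (m.component Y) x).mdifferentiable (by simp) 1).sub
    (mdifferentiableAt_toCLM_adInv m x Y)

/-- The derivative at `1` of the defect of `m`. -/
theorem mfderiv_defect [FiniteDimensional ℝ E] (hm : IsMomentumMap π m)
    (X Y : GroupLieAlgebra 𝓘(ℝ, E) G) (x : P) :
    mfderiv 𝓘(ℝ, E) 𝓘(ℝ, ℝ) (fun g : G ↦ m.defect g x Y) 1 X = (casimirCocycle hm X Y).1 x := by
  have h1 := ((contMDiff_orbit (m.component Y) x).mdifferentiable (by simp) 1).hasMFDerivAt.sub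
    (mdifferentiableAt_toCLM_adInv (E := E) (G := G) m x Y).hasMFDerivAt
  have h2 := derivOne_clm_comp (mdifferentiableAt_adInv_one (E := E) (G := G) Y) (m.toCLM x) X
  have h3 : derivOne E (fun g : G ↦ m.toCLM x (adInv (E := E) Y g)) X = -m.component ⁅X, Y⁆ x := by
    rw [h2]
    exact (congrArg (m.toCLM x) (derivOne_adInv X Y)).trans (map_neg (m.toFun x) _)
  rw [← mfderiv_one_eq_derivOne] at h3
  have h4 : mfderiv 𝓘(ℝ, E) 𝓘(ℝ, ℝ) (fun g : G ↦ m.component Y (g • x)) 1 X =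
      π.bracket (m.component Y) (m.component X) x := hm X (m.component Y) x
  refine (DFunLike.congr_fun h1.mfderiv X).trans ?_
  change (_ - _ : ℝ) = m.component ⁅X, Y⁆ x - π.bracket (m.component X) (m.component Y) x
  refine (congrArg₂ (fun a b : ℝ ↦ a - b) h4 h3).trans ?_
  rw [π.skew (m.component X)]
  change _ = _ - -(π.bracket (m.component Y) (m.component X) x)
  ring

end MomentumMap

/-! ### Propagating a vanishing derivative by translations. -/

section Translation

variable {E : Type*} [NormedAddCommGroup E] [NormedSpace ℝ E]
  {G : Type*} [TopologicalSpace G] [ChartedSpace E G] [Group G] [LieGroup 𝓘(ℝ, E) ∞ G]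
  {V : Type*} [NormedAddCommGroup V] [NormedSpace ℝ V]

theorem hasMFDerivAt_zero_of_mul_right {ψ : G → V} {g : G}
    (h : HasMFDerivAt 𝓘(ℝ, E) 𝓘(ℝ, V) (fun k ↦ ψ (k * g)) 1 0) :
    HasMFDerivAt 𝓘(ℝ, E) 𝓘(ℝ, V) ψ g 0 := by
  have h1 := ((contMDiff_mul_right (I := 𝓘(ℝ, E)) (n := ∞) (a := g⁻¹)).mdifferentiable
    (by simp) g).hasMFDerivAt
  have h' : HasMFDerivAt 𝓘(ℝ, E) 𝓘(ℝ, V) (fun k ↦ ψ (k * g)) (g * g⁻¹) 0 := by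
    rwa [mul_inv_cancel]
  have h2 := h'.comp g h1
  rw [ContinuousLinearMap.zero_comp] at h2
  have e : (fun k ↦ ψ (k * g)) ∘ (fun k ↦ k * g⁻¹) = ψ := by ext k; simp
  rw [e] at h2
  exact h2

theorem hasMFDerivAt_zero_of_mul_left {ψ : G → V} {g : G}
    (h : HasMFDerivAt 𝓘(ℝ, E) 𝓘(ℝ, V) (fun k ↦ ψ (g * k)) 1 0) :
    HasMFDerivAt 𝓘(ℝ, E) 𝓘(ℝ, V) ψ g 0 := by
  have h1 := ((contMDiff_mul_left (I := 𝓘(ℝ, E)) (n := ∞) (a := g⁻¹)).mdifferentiable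
    (by simp) g).hasMFDerivAt
  have h' : HasMFDerivAt 𝓘(ℝ, E) 𝓘(ℝ, V) (fun k ↦ ψ (g * k)) (g⁻¹ * g) 0 := by
    rwa [inv_mul_cancel]
  have h2 := h'.comp g h1
  rw [ContinuousLinearMap.zero_comp] at h2
  have e : (fun k ↦ ψ (g * k)) ∘ (fun k ↦ g⁻¹ * k) = ψ := by ext k; simp
  rw [e] at h2
  exact h2

theorem isOpen_connectedComponent_one (E : Type*) [NormedAddCommGroup E] [NormedSpace ℝ E]
    (G : Type*) [TopologicalSpace G] [ChartedSpace E G] [Group G] :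
    IsOpen (connectedComponent (1 : G)) := by
  have : LocallyConnectedSpace G := ChartedSpace.locallyConnectedSpace E G
  exact isOpen_connectedComponent

theorem eq_of_hasMFDerivAt_zero_of_mem_connectedComponent {f : G → V}
    (hf : ∀ g ∈ connectedComponent (1 : G), HasMFDerivAt 𝓘(ℝ, E) 𝓘(ℝ, V) f g 0) {g : G}
    (hg : g ∈ connectedComponent (1 : G)) : f g = f 1 :=
  eq_of_mfderiv_eq_zero (isOpen_connectedComponent_one E G) isPreconnected_connectedComponent hf
    hg mem_connectedComponent

end Translation

/-! ### The group cocycle and the cohomological criteria. -/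

section Equivariance

variable {E : Type*} [NormedAddCommGroup E] [NormedSpace ℝ E]
  {F : Type*} [NormedAddCommGroup F] [NormedSpace ℝ F]
  {G : Type*} [TopologicalSpace G] [ChartedSpace E G] [Group G] [LieGroup 𝓘(ℝ, E) ∞ G]
  {P : Type*} [TopologicalSpace P] [ChartedSpace F P] [MulAction G P]
  [ContMDiffSMul 𝓘(ℝ, E) 𝓘(ℝ, F) ∞ G P]
  {π : PoissonStructure F P} {m : SmoothMapToDual E F G P}

/-- Casimir functions are invariant under the identity component of `G`. -/
theorem IsMomentumMap.casimir_smul (hm : IsMomentumMap π m) {c : Smooth F P} (hc : c ∈ Casimir π)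
    {g : G} (hg : g ∈ connectedComponent (1 : G)) (x : P) : c (g • x) = c x := by
  have key : ∀ y : P, HasMFDerivAt 𝓘(ℝ, E) 𝓘(ℝ, ℝ) (fun k : G ↦ c (k • y)) 1 0 := by
    intro y
    have h1 := ((contMDiff_orbit (E := E) (G := G) c y).mdifferentiable (by simp) 1).hasMFDerivAt
    have h2 : mfderiv 𝓘(ℝ, E) 𝓘(ℝ, ℝ) (fun k : G ↦ c (k • y)) 1 = 0 := by
      ext X
      refine (hm X c y).trans ?_
      rw [hc]
      rfl
    rwa [h2] at h1
  have h3 : (fun k : G ↦ c (k • x)) g = (fun k : G ↦ c (k • x)) 1 := by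
    refine eq_of_hasMFDerivAt_zero_of_mem_connectedComponent (E := E) (V := ℝ)
      (f := fun k : G ↦ c (k • x)) (fun k _ ↦ ?_) hg
    -- Right translation by `k` turns the orbit map of `x` into that of `k • x`, whose derivative at
    -- `1` vanishes by `key`.
    refine hasMFDerivAt_zero_of_mul_right (E := E) (V := ℝ) (ψ := fun k ↦ c (k • x)) ?_
    exact (key (k • x)).congr_of_eventuallyEq
      (Eventually.of_forall fun j ↦ congrArg c (mul_smul j k x))
  simpa using h3

theorem SmoothMapToDual.defect_mul (m : SmoothMapToDual E F G P) (g h : G) (x : P)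
    (Y : GroupLieAlgebra 𝓘(ℝ, E) G) :
    m.defect (g * h) x Y = m.defect g (h • x) Y + m.defect h x (Ad E g⁻¹ Y) := by
  simp only [SmoothMapToDual.defect, LinearMap.sub_apply, LinearMap.comp_apply, mul_inv_rev,
    Ad_mul, mul_smul]
  ring

/-- The composition rule for the defect evaluates the first term at `h • x`; Casimir invariance
replaces this by `x`. Only `h` must lie in the identity component, which the compact case exploits
for disconnected `G`. -/
theorem casimirDefect_mul (hPoisson : IsPoissonAction E G π) (hm : IsMomentumMap π m) (g : G)
    {h : G} (hh : h ∈ connectedComponent (1 : G)) (Y : GroupLieAlgebra 𝓘(ℝ, E) G) :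
    casimirDefect hPoisson hm (g * h) Y =
      casimirDefect hPoisson hm g Y + casimirDefect hPoisson hm h (Ad E g⁻¹ Y) := by
  ext x
  change m.defect (g * h) x Y = m.defect g x Y + m.defect h x (Ad E g⁻¹ Y)
  rw [m.defect_mul, ← casimirDefect_apply hPoisson hm g Y (h • x),
    hm.casimir_smul (casimirDefect hPoisson hm g Y).2 hh, casimirDefect_apply]

/-- The map `m + c` for a linear map `c : 𝔤 → Car(P)`. -/
def SmoothMapToDual.addCasimir (m : SmoothMapToDual E F G P)
    (c : GroupLieAlgebra 𝓘(ℝ, E) G →ₗ[ℝ] Casimir π) : SmoothMapToDual E F G P where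
  toFun x :=
    { toFun := fun X ↦ m.toFun x X + (c X).1 x
      map_add' := fun X Y ↦ by
        rw [map_add, map_add]
        change _ + ((c X).1 x + (c Y).1 x) = _
        ring
      map_smul' := fun t X ↦ by
        rw [map_smul, map_smul]
        change t * _ + t * (c X).1 x = t * _
        ring }
  smooth X := (m.smooth X).add (c X).1.contMDiff

theorem SmoothMapToDual.addCasimir_apply (m : SmoothMapToDual E F G P)
    (c : GroupLieAlgebra 𝓘(ℝ, E) G →ₗ[ℝ] Casimir π) (x : P) (X : GroupLieAlgebra 𝓘(ℝ, E) G) :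
    (m.addCasimir c).toFun x X = m.toFun x X + (c X).1 x := rfl

theorem SmoothMapToDual.component_addCasimir (m : SmoothMapToDual E F G P)
    (c : GroupLieAlgebra 𝓘(ℝ, E) G →ₗ[ℝ] Casimir π) (X : GroupLieAlgebra 𝓘(ℝ, E) G) :
    (m.addCasimir c).component X = m.component X + (c X).1 := rfl

theorem IsMomentumMap.addCasimir (hm : IsMomentumMap π m)
    (c : GroupLieAlgebra 𝓘(ℝ, E) G →ₗ[ℝ] Casimir π) : IsMomentumMap π (m.addCasimir c) := by
  intro X f x
  rw [hm, m.component_addCasimir, map_add, bracket_casimir_right π (c X).2, add_zero]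

/-- The difference of two momentum maps takes values in the Casimir functions. -/
def momentumDifference {m' : SmoothMapToDual E F G P} (hm' : IsMomentumMap π m')
    (hm : IsMomentumMap π m) : GroupLieAlgebra 𝓘(ℝ, E) G →ₗ[ℝ] Casimir π :=
  (m'.componentLinear - m.componentLinear).codRestrict (Casimir π) fun X ↦
    mem_casimir_of_bracket_right π fun f ↦ by
      ext x
      change π.bracket f (m'.component X - m.component X) x = 0
      rw [map_sub]
      change π.bracket f (m'.component X) x - π.bracket f (m.component X) x = 0
      rw [← hm, ← hm', sub_self]

/-- The difference of two momentum maps is a `c` with `G`-invariant values, and `m + c` is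
equivariant exactly when `Ψ(g) = g · c - c`. -/
theorem hasEquivariantMomentumMap_iff [ConnectedSpace G] (hPoisson : IsPoissonAction E G π)
    (hm : IsMomentumMap π m) :
    HasEquivariantMomentumMap E G π ↔
      IsGroupOneCoboundary (coadjointRep E G (Casimir π)) (casimirDefect hPoisson hm) := by
  have hconn : ∀ g : G, g ∈ connectedComponent (1 : G) := fun g ↦ by
    rw [PreconnectedSpace.connectedComponent_eq_univ]; trivial
  constructor
  · rintro ⟨m', hm', heq⟩
    refine ⟨momentumDifference hm' hm, fun g ↦ ?_⟩
    ext Y x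
    have h1 := hm.casimir_smul (momentumDifference hm' hm Y).2 (hconn g) x
    change m'.toFun (g • x) Y - m.toFun (g • x) Y = m'.toFun x Y - m.toFun x Y at h1
    change m.toFun (g • x) Y - m.toFun x (Ad E g⁻¹ Y) =
      (m'.toFun x (Ad E g⁻¹ Y) - m.toFun x (Ad E g⁻¹ Y)) - (m'.toFun x Y - m.toFun x Y)
    have h2 := DFunLike.congr_fun (heq g x) Y
    rw [LinearMap.comp_apply] at h2
    linarith
  · rintro ⟨c, hc⟩
    refine ⟨m.addCasimir c, hm.addCasimir c, fun g x ↦ ?_⟩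
    ext Y
    have h1 := hm.casimir_smul (c Y).2 (hconn g) x
    have h2 : m.toFun (g • x) Y - m.toFun x (Ad E g⁻¹ Y) =
        (c (Ad E g⁻¹ Y)).1 x - (c Y).1 x :=
      congrArg (fun a : GroupLieAlgebra 𝓘(ℝ, E) G →ₗ[ℝ] Casimir π ↦ (a Y).1 x) (hc g)
    rw [LinearMap.comp_apply, m.addCasimir_apply, m.addCasimir_apply, h1]
    linarith

variable [CompleteSpace E]

/-- `Γ` as a `2`-cochain with values in the trivial module `Car(P)`. -/
def trivialCocycle (hm : IsMomentumMap π m) :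
    LieModule.Cohomology.twoCochain ℝ (GroupLieAlgebra 𝓘(ℝ, E) G) (TrivialCasimir E G π) :=
  ⟨(casimirCocycle hm).compr₂
    (TrivialLieModule.equiv ℝ (GroupLieAlgebra 𝓘(ℝ, E) G) (Casimir π)).symm.toLinearMap,
    fun X ↦ by
      rw [LinearMap.compr₂_apply, casimirCocycle_self, map_zero]⟩

theorem trivialCocycle_apply (hm : IsMomentumMap π m) (X Y : GroupLieAlgebra 𝓘(ℝ, E) G) :
    trivialCocycle hm X Y = (TrivialLieModule.equiv ℝ (GroupLieAlgebra 𝓘(ℝ, E) G)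
      (Casimir π)).symm (casimirCocycle hm X Y) := rfl

theorem trivialCocycle_mem (hm : IsMomentumMap π m) :
    trivialCocycle hm ∈ LieModule.Cohomology.twoCocycle ℝ (GroupLieAlgebra 𝓘(ℝ, E) G)
      (TrivialCasimir E G π) := by
  rw [LieModule.Cohomology.mem_twoCocycle_iff_of_trivial]
  intro X Y Z
  rw [trivialCocycle_apply, trivialCocycle_apply, trivialCocycle_apply, casimirCocycle_cocycle,
    map_add]

theorem hasEquivariantMomentumMap_of_vanishing (hPoisson : IsPoissonAction E G π)
    (hm : IsMomentumMap π m)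
    (h1 : LieH1Vanishes (GroupLieAlgebra 𝓘(ℝ, E) G) (TrivialCasimir E G π))
    (h2 : LieH2Vanishes (GroupLieAlgebra 𝓘(ℝ, E) G) (TrivialCasimir E G π)) :
    HasEquivariantMomentumMap E G π := by
  obtain ⟨c, hc⟩ := h2 (trivialCocycle_mem hm)
  set e := TrivialLieModule.equiv ℝ (GroupLieAlgebra 𝓘(ℝ, E) G) (Casimir π)
  set c' : GroupLieAlgebra 𝓘(ℝ, E) G →ₗ[ℝ] Casimir π := e.toLinearMap ∘ₗ c with hc'
  -- With trivial coefficients the differential of `c` is `-c([X, Y])`, so adding `c'` to `m`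
  -- cancels `Γ`.
  have hcX : ∀ X Y, -c' ⁅X, Y⁆ = casimirCocycle hm X Y := by
    intro X Y
    have h3 := DFunLike.congr_fun (DFunLike.congr_fun hc X) Y
    rw [LieModule.Cohomology.d₁₂_apply_apply_ofTrivial, trivialCocycle_apply] at h3
    have h4 := congrArg e h3
    rwa [map_neg, LinearEquiv.apply_symm_apply] at h4
  set m' := m.addCasimir c' with hm'def
  have hm' : IsMomentumMap π m' := hm.addCasimir c'
  have hlie : ∀ X Y, m'.component ⁅X, Y⁆ = π.bracket (m'.component X) (m'.component Y) := by
    intro X Y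
    have h3 := congrArg (Subtype.val) (hcX X Y)
    rw [casimirCocycle_coe] at h3
    rw [hm'def, m.component_addCasimir, m.component_addCasimir, m.component_addCasimir, map_add,
      bracket_casimir_right π (c' Y).2, add_zero, map_add, LinearMap.add_apply, (c' X).2, add_zero]
    rw [Submodule.coe_neg] at h3
    rw [← sub_eq_zero, add_sub_right_comm, ← h3, neg_add_cancel]
  refine ⟨m', hm', fun g x ↦ ?_⟩
  set d : GroupLieAlgebra 𝓘(ℝ, E) G →ₗ[ℝ] TrivialCasimir E G π :=
    e.symm.toLinearMap ∘ₗ casimirDefect hPoisson hm' g with hd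
  have hker : d ∈ LinearMap.ker (LieModule.Cohomology.d₁₂ ℝ (GroupLieAlgebra 𝓘(ℝ, E) G)
      (TrivialCasimir E G π)) := by
    rw [LinearMap.mem_ker]
    apply DFunLike.ext
    intro X
    ext1 Y
    rw [LieModule.Cohomology.d₁₂_apply_apply_ofTrivial]
    -- In `{m'(X) ∘ σ_g, m'(Y) ∘ σ_g}` each entry may be replaced by its `Ad_{g⁻¹}` counterpart,
    -- since they differ by Casimir functions.
    have h3 : casimirDefect hPoisson hm' g ⁅X, Y⁆ = 0 := by
      apply Subtype.ext
      change translate E g (m'.component ⁅X, Y⁆) - m'.component (Ad E g⁻¹ ⁅X, Y⁆) = 0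
      rw [Ad_lie, hlie, hlie, ← hPoisson, hm'.bracket_translate hPoisson,
        π.skew _ (m'.component (Ad E g⁻¹ Y)), hm'.bracket_translate hPoisson,
        π.skew _ (m'.component (Ad E g⁻¹ X)), neg_neg, sub_self]
    rw [hd, LinearMap.comp_apply, h3, map_zero, neg_zero]
    rfl
  obtain ⟨v, hv⟩ := h1 hker
  -- On a trivial module every `1`-coboundary is zero.
  have hd0 : d = 0 := by
    rw [← hv]
    ext1 X
    exact LieModule.IsTrivial.trivial X v
  ext Y
  have h5 : casimirDefect hPoisson hm' g Y = 0 := by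
    have := DFunLike.congr_fun hd0 Y
    rw [hd, LinearMap.comp_apply] at this
    exact e.symm.map_eq_zero_iff.1 this
  have h6 : m'.toFun (g • x) Y - m'.toFun x (Ad E g⁻¹ Y) = 0 :=
    congrArg (fun a : Casimir π ↦ a.1 x) h5
  exact sub_eq_zero.1 h6

end Equivariance

/-! ### Whitehead's lemmas for trivial coefficients. -/

section Whitehead

open scoped TensorProduct

variable {L : Type*} [LieRing L] [LieAlgebra ℝ L] [FiniteDimensional ℝ L] [LieAlgebra.IsKilling ℝ L]

theorem killingForm_eq_zero {z : L} (hz : ∀ y, killingForm ℝ L z y = 0) : z = 0 :=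
  (LieAlgebra.IsKilling.killingForm_nondegenerate ℝ L).1 z hz

theorem killingForm_lie_left (x y z : L) : killingForm ℝ L ⁅x, y⁆ z = killingForm ℝ L x ⁅y, z⁆ :=
  LieModule.traceForm_apply_lie_apply ℝ L L x y z

/-- Every linear form on `L` is represented by the Killing form. -/
theorem exists_killingForm_eq (φ : Module.Dual ℝ L) : ∃ z : L, killingForm ℝ L z = φ := by
  have hinj : Function.Injective (killingForm ℝ L : L →ₗ[ℝ] Module.Dual ℝ L) := by
    rw [← LinearMap.ker_eq_bot]
    exact (Submodule.eq_bot_iff _).2 fun z hz ↦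
      killingForm_eq_zero fun y ↦ DFunLike.congr_fun hz y
  exact (LinearMap.injective_iff_surjective_of_finrank_eq_finrank
    (Subspace.dual_finrank_eq (K := ℝ) (V := L)).symm).1 hinj φ

/-- Represent `φ` as `κ(z, ·)`. By invariance of the Killing form `z` is central, so `ad z = 0` and
`z` is in the radical of `κ`. -/
theorem dual_eq_zero_of_lie {φ : Module.Dual ℝ L} (hφ : ∀ x y : L, φ ⁅x, y⁆ = 0) : φ = 0 := by
  obtain ⟨z, rfl⟩ := exists_killingForm_eq φ
  have h1 : ∀ x : L, ⁅z, x⁆ = 0 := fun x ↦ killingForm_eq_zero fun y ↦ by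
    rw [killingForm_lie_left, hφ]
  have h2 : z = 0 := killingForm_eq_zero fun y ↦ by
    have h3 : LieAlgebra.ad ℝ L z = 0 := LinearMap.ext h1
    rw [killingForm_apply_apply, h3, LinearMap.zero_comp, map_zero]
  rw [h2, map_zero]

theorem linearMap_eq_zero_of_lie {V : Type*} [AddCommGroup V] [Module ℝ V] {f : L →ₗ[ℝ] V}
    (hf : ∀ x y : L, f ⁅x, y⁆ = 0) : f = 0 := by
  ext x
  rw [LinearMap.zero_apply, ← Module.forall_dual_apply_eq_zero_iff ℝ]
  intro φ
  have : φ ∘ₗ f = 0 := dual_eq_zero_of_lie fun x y ↦ by simp [hf]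
  exact DFunLike.congr_fun this x

/-- Write `θ(x, y) = κ(D x, y)`. The cocycle identity says that `D` is a derivation; derivations are
inner, `D = ad z`, and invariance yields `c = κ(z, ·)`. -/
theorem exists_dual_lie_eq (θ : L →ₗ[ℝ] L →ₗ[ℝ] ℝ) (halt : ∀ x, θ x x = 0)
    (hθ : ∀ x y z : L, θ x ⁅y, z⁆ = θ ⁅x, y⁆ z + θ y ⁅x, z⁆) :
    ∃ c : Module.Dual ℝ L, ∀ x y : L, c ⁅x, y⁆ = θ x y := by
  have hskew : ∀ x y, θ x y = -θ y x := fun x y ↦ by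
    have := halt (x + y)
    simp only [map_add, LinearMap.add_apply, halt] at this
    linarith
  choose D hD using fun x ↦ exists_killingForm_eq (θ x)
  have hDx : ∀ x y, killingForm ℝ L (D x) y = θ x y := fun x y ↦ by rw [hD]
  have hext : ∀ a b : L, (∀ y, killingForm ℝ L a y = killingForm ℝ L b y) → a = b := fun a b h ↦
    sub_eq_zero.1 (killingForm_eq_zero fun y ↦ by rw [map_sub, LinearMap.sub_apply, h, sub_self])
  let D' : LieDerivation ℝ L L :=
    { toFun := D
      map_add' := fun x y ↦ hext _ _ fun z ↦ by
        simp only [map_add, LinearMap.add_apply, hDx]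
      map_smul' := fun t x ↦ hext _ _ fun z ↦ by
        simp only [map_smul, LinearMap.smul_apply, hDx, RingHom.id_apply]
      leibniz' := fun x y ↦ hext _ _ fun z ↦ by
        change killingForm ℝ L (D ⁅x, y⁆) z = killingForm ℝ L (⁅x, D y⁆ - ⁅y, D x⁆) z
        rw [← lie_skew x (D y), ← lie_skew y (D x), map_sub, LinearMap.sub_apply, map_neg, map_neg,
          LinearMap.neg_apply, LinearMap.neg_apply, killingForm_lie_left, killingForm_lie_left,
          hDx, hDx, hDx, hθ x y z]
        ring }
  obtain ⟨z, hz⟩ := LieDerivation.IsKilling.exists_eq_ad D'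
  refine ⟨killingForm ℝ L z, fun x y ↦ ?_⟩
  have h1 : ⁅z, x⁆ = D x := by
    have h2 := DFunLike.congr_fun hz x
    rwa [LieDerivation.ad_apply_apply] at h2
  rw [← killingForm_lie_left, h1, hDx]

/-- `V` may be infinite-dimensional, so scalar primitives are not assembled directly. They show
instead that `θ` kills the kernel of the bracket map `L ⊗ L → L`; this map is surjective, so `θ`
factors through it. -/
theorem exists_linearMap_lie_eq {V : Type*} [AddCommGroup V] [Module ℝ V]
    (θ : L →ₗ[ℝ] L →ₗ[ℝ] V) (halt : ∀ x, θ x x = 0)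
    (hθ : ∀ x y z : L, θ x ⁅y, z⁆ = θ ⁅x, y⁆ z + θ y ⁅x, z⁆) :
    ∃ c : L →ₗ[ℝ] V, ∀ x y : L, c ⁅x, y⁆ = θ x y := by
  set T : TensorProduct ℝ L L →ₗ[ℝ] L := 
    TensorProduct.lift (LieModule.toEnd ℝ L L : L →ₗ[ℝ] Module.End ℝ L)
  set Ω : TensorProduct ℝ L L →ₗ[ℝ] V := TensorProduct.lift θ
  have hT : ∀ x y : L, T (x ⊗ₜ y) = ⁅x, y⁆ := fun x y ↦ by simp [T]
  have hsurj : LinearMap.range T = ⊤ := by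
    by_contra hne
    obtain ⟨x, hx⟩ : ∃ x, x ∉ LinearMap.range T := by
      by_contra h
      push Not at h
      exact hne ((Submodule.eq_top_iff').2 h)
    obtain ⟨φ, hφ, hle⟩ := Submodule.exists_le_ker_of_notMem hx
    refine hφ ?_
    rw [dual_eq_zero_of_lie (φ := φ) fun a b ↦ ?_, LinearMap.zero_apply]
    exact hle ⟨a ⊗ₜ b, hT a b⟩
  obtain ⟨s, hs⟩ := T.exists_rightInverse_of_surjective hsurj
  have hker : ∀ t, T t = 0 → Ω t = 0 := by
    intro t ht
    rw [← Module.forall_dual_apply_eq_zero_iff ℝ]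
    intro φ
    obtain ⟨c, hc⟩ := exists_dual_lie_eq (θ.compr₂ φ) (fun x ↦ by simp [halt])
      (fun x y z ↦ by simp [hθ x y z])
    have h1 : φ ∘ₗ Ω = c ∘ₗ T := by
      ext x y
      simp [hT, hc, Ω]
    exact (DFunLike.congr_fun h1 t).trans (by simp [ht])
  refine ⟨Ω ∘ₗ s, fun x y ↦ ?_⟩
  have h1 : T (s ⁅x, y⁆ - x ⊗ₜ y) = 0 := by
    have := DFunLike.congr_fun hs ⁅x, y⁆
    rw [map_sub, hT, sub_eq_zero]
    exact this
  have h2 := hker _ h1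
  rw [map_sub, sub_eq_zero] at h2
  rw [LinearMap.comp_apply, h2]
  simp [Ω]

variable (L) (V : Type*) [AddCommGroup V] [Module ℝ V] [LieRingModule L V] [LieModule ℝ L V]
  [LieModule.IsTrivial L V]

/-- Whitehead's first lemma for trivial coefficients. -/
theorem lieH1Vanishes_of_isKilling : LieH1Vanishes L V := by
  intro f hf
  have : f = 0 := linearMap_eq_zero_of_lie fun x y ↦ by
    have h1 := DFunLike.congr_fun (DFunLike.congr_fun (LinearMap.mem_ker.1 hf) x) y
    rw [LieModule.Cohomology.d₁₂_apply_apply_ofTrivial] at h1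
    exact neg_eq_zero.1 h1
  rw [this]
  exact zero_mem _

/-- Whitehead's second lemma for trivial coefficients. -/
theorem lieH2Vanishes_of_isKilling : LieH2Vanishes L V := by
  intro a ha
  rw [LieModule.Cohomology.mem_twoCocycle_iff_of_trivial] at ha
  obtain ⟨c, hc⟩ := exists_linearMap_lie_eq a.1 a.2 ha
  refine ⟨-c, ?_⟩
  apply DFunLike.ext
  intro x
  ext1 y
  rw [LieModule.Cohomology.d₁₂_apply_apply_ofTrivial, LinearMap.neg_apply, neg_neg, hc]
  rfl

end Whitehead

/-! ### Finite-dimensional spaces of functions and their point evaluations. -/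

section Evaluations

variable {V : Type*} [AddCommGroup V] [Module ℝ V] {P : Type*} {ev : P → Module.Dual ℝ V}

theorem span_range_eq_top_of_separating [FiniteDimensional ℝ V]
    (hev : ∀ v, (∀ x, ev x v = 0) → v = 0) : Submodule.span ℝ (Set.range ev) = ⊤ := by
  have h1 : (Submodule.span ℝ (Set.range ev)).dualCoannihilator = ⊥ := by
    rw [Submodule.eq_bot_iff]
    intro v hv
    rw [Submodule.mem_dualCoannihilator] at hv
    exact hev v fun x ↦ hv _ (Submodule.subset_span ⟨x, rfl⟩)
  rw [← Subspace.dualCoannihilator_dualAnnihilator_eq (W := Submodule.span ℝ (Set.range ev)), h1,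
    Submodule.dualAnnihilator_bot]

/-- A finite-dimensional space of functions is cut out by finite combinations of evaluations. -/
theorem mem_of_annihilated (hev : ∀ v, (∀ x, ev x v = 0) → v = 0) (W : Submodule ℝ V)
    [FiniteDimensional ℝ W] {f : V}
    (hf : ∀ (t : Finset P) (a : P → ℝ), (∀ w ∈ W, ∑ x ∈ t, a x * ev x w = 0) →
      ∑ x ∈ t, a x * ev x f = 0) : f ∈ W := by
  by_contra hfW
  obtain ⟨φ, hφ, hle⟩ := Submodule.exists_le_ker_of_notMem hfW
  -- On the finite-dimensional `U` the functional `φ`, which kills `W` but not `f`, is a finite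
  -- combination of evaluations.
  set U := W ⊔ Submodule.span ℝ {f}
  have hfU : f ∈ U := le_sup_right (a := W) (Submodule.mem_span_singleton_self f)
  have htop := span_range_eq_top_of_separating (V := U) (ev := fun x ↦ (ev x).domRestrict U)
    fun v hv ↦ Subtype.ext (hev v.1 hv)
  have hmem : φ.domRestrict U ∈
      Submodule.span ℝ (Set.range fun x ↦ (ev x).domRestrict U) := by
    rw [htop]; trivial
  obtain ⟨l, hl⟩ := Finsupp.mem_span_range_iff_exists_finsupp.1 hmem
  have key : ∀ u ∈ U, ∑ x ∈ l.support, l x * ev x u = φ u := by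
    intro u hu
    have h1 := DFunLike.congr_fun hl ⟨u, hu⟩
    rw [Finsupp.sum, LinearMap.sum_apply] at h1
    exact h1
  refine hφ ?_
  rw [← key f hfU]
  refine hf _ _ fun w hw ↦ ?_
  rw [key w (le_sup_left (a := W) hw)]
  exact hle hw

open MeasureTheory in
/-- The pointwise mean of a family in a finite-dimensional space of functions belongs to it. -/
theorem exists_eq_integral [FiniteDimensional ℝ V] (hev : ∀ v, (∀ x, ev x v = 0) → v = 0)
    {G : Type*} [TopologicalSpace G] [CompactSpace G] [MeasurableSpace G] [BorelSpace G]
    (μ : Measure G) [IsFiniteMeasure μ] {h : G → V} (hh : ∀ x, Continuous fun g ↦ ev x (h g)) :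
    ∃ w : V, ∀ x, ev x w = ∫ g, ev x (h g) ∂μ := by
  have hcont : ∀ φ : Module.Dual ℝ V, Continuous fun g ↦ φ (h g) := by
    intro φ
    -- Coordinates are finite combinations of evaluations, so pointwise continuity of `h` makes them
    -- continuous.
    have hφ : φ ∈ Submodule.span ℝ (Set.range ev) := by
      rw [span_range_eq_top_of_separating hev]; trivial
    induction hφ using Submodule.span_induction with
    | mem φ hφ => obtain ⟨x, rfl⟩ := hφ; exact hh x
    | zero => exact continuous_const
    | add φ ψ _ _ h1 h2 => exact h1.add h2
    | smul t φ _ h1 => exact h1.const_smul t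
  have hint : ∀ φ : Module.Dual ℝ V, Integrable (fun g ↦ φ (h g)) μ := fun φ ↦
    (hcont φ).integrable_of_hasCompactSupport (HasCompactSupport.of_compactSpace _)
  set b := Module.finBasis ℝ V
  refine ⟨∑ i, (∫ g, b.coord i (h g) ∂μ) • b i, fun x ↦ ?_⟩
  have h1 : ∀ g, ev x (h g) = ∑ i, b.coord i (h g) * ev x (b i) := by
    intro g
    conv_lhs => rw [← b.sum_repr (h g), map_sum]
    simp
  simp_rw [h1, map_sum, map_smul, smul_eq_mul]
  rw [integral_finsetSum _ fun i _ ↦ (hint (b.coord i)).mul_const _]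
  simp_rw [integral_mul_const]

end Evaluations

/-! ### Averaging over a compact group. -/

section Compact

variable {E : Type*} [NormedAddCommGroup E] [NormedSpace ℝ E] [FiniteDimensional ℝ E]
  [CompleteSpace E]
  {F : Type*} [NormedAddCommGroup F] [NormedSpace ℝ F]
  {G : Type*} [TopologicalSpace G] [ChartedSpace E G] [Group G] [LieGroup 𝓘(ℝ, E) ∞ G]
  {P : Type*} [TopologicalSpace P] [ChartedSpace F P] [MulAction G P]
  [ContMDiffSMul 𝓘(ℝ, E) 𝓘(ℝ, F) ∞ G P]
  {π : PoissonStructure F P} {m : SmoothMapToDual E F G P}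

instance : FiniteDimensional ℝ (GroupLieAlgebra 𝓘(ℝ, E) G) :=
  inferInstanceAs (FiniteDimensional ℝ E)

/-- Evaluation of Casimir functions at a point. -/
def casimirEval (π : PoissonStructure F P) (x : P) : Module.Dual ℝ (Casimir π) where
  toFun c := c.1 x
  map_add' _ _ := rfl
  map_smul' _ _ := rfl

theorem casimirEval_separating (v : Casimir π) (hv : ∀ x, casimirEval π x v = 0) : v = 0 := by
  ext x
  exact hv x

/-- The span of the functions `Γ_{X, Y}`. -/
def cocycleSpan (hm : IsMomentumMap π m) : Submodule ℝ (Casimir π) :=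
  LinearMap.range (TensorProduct.lift (casimirCocycle hm))

theorem casimirCocycle_mem_cocycleSpan (hm : IsMomentumMap π m)
    (X Y : GroupLieAlgebra 𝓘(ℝ, E) G) : casimirCocycle hm X Y ∈ cocycleSpan hm :=
  ⟨TensorProduct.tmul ℝ X Y, TensorProduct.lift.tmul X Y⟩

instance (hm : IsMomentumMap π m) : FiniteDimensional ℝ (cocycleSpan hm) :=
  LinearMap.finiteDimensional_range _

/-- A finite combination of evaluations that kills every `Γ_{X, Z}` makes the defect's derivative at
`1` vanish for all `Z`. The cocycle rule carries this along the identity component, where the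
combination is therefore constant, equal to its value zero at `1`. -/
theorem casimirDefect_mem_cocycleSpan (hPoisson : IsPoissonAction E G π) (hm : IsMomentumMap π m)
    {g : G} (hg : g ∈ connectedComponent (1 : G)) (Y : GroupLieAlgebra 𝓘(ℝ, E) G) :
    casimirDefect hPoisson hm g Y ∈ cocycleSpan hm := by
  refine mem_of_annihilated casimirEval_separating _ fun t a hta ↦ ?_
  set u : G → GroupLieAlgebra 𝓘(ℝ, E) G → ℝ := fun k Z ↦ ∑ x ∈ t, a x * m.defect k x Z
  have hu0 : ∀ Z, HasFDerivAt (fun v ↦ u ((extChartAt 𝓘(ℝ, E) (1 : G)).symm v) Z)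
      (0 : E →L[ℝ] ℝ) (extChartAt 𝓘(ℝ, E) (1 : G) 1) := by
    intro Z
    have h1 := HasFDerivAt.fun_sum (u := t) fun x _ ↦
      (hasFDerivAt_extChartAt_one_symm (mdifferentiableAt_defect m x Z)).const_mul (a x)
    refine h1.congr_fderiv ?_
    ext X
    have h2 := hta _ (casimirCocycle_mem_cocycleSpan hm X Z)
    rw [sum_apply, zero_apply, ← h2]
    refine Finset.sum_congr rfl fun x _ ↦ ?_
    rw [← mfderiv_one_eq_derivOne]
    exact congrArg (fun r : ℝ ↦ a x * r) (mfderiv_defect hm X Z x)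
  have hu : (fun k ↦ u k Y) g = (fun k ↦ u k Y) 1 := by
    refine eq_of_hasMFDerivAt_zero_of_mem_connectedComponent (E := E) (V := ℝ)
      (f := fun k ↦ u k Y) (fun k _ ↦ ?_) hg
    refine hasMFDerivAt_zero_of_mul_left (E := E) (V := ℝ) (ψ := fun k ↦ u k Y) ?_
    -- The cocycle rule needs `j` in the identity component, which is a neighbourhood of `1`.
    have h1 : (fun j ↦ u (k * j) Y) =ᶠ[𝓝 1] fun j ↦ u k Y + u j (Ad E k⁻¹ Y) := by
      filter_upwards [(isOpen_connectedComponent_one E G).mem_nhds mem_connectedComponent] with j hj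
      simp only [u]
      rw [← Finset.sum_add_distrib]
      refine Finset.sum_congr rfl fun x _ ↦ ?_
      have h2 := congrArg (casimirEval π x) (casimirDefect_mul hPoisson hm k hj Y)
      rw [← mul_add]
      exact congrArg (fun r : ℝ ↦ a x * r) h2
    exact hasMFDerivAt_one_of_extChartAt
      (((hu0 (Ad E k⁻¹ Y)).const_add (u k Y)).congr_of_eventuallyEq
      (tendsto_extChartAt_one_symm.eventually h1))
  have h1 : u 1 Y = 0 := Finset.sum_eq_zero fun x _ ↦ by
    simp [SmoothMapToDual.defect, Ad_one]
  exact hu.trans h1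

/-- All the functions `Ψ(g)(Y)` lie in a finite-dimensional space if `G` is compact. -/
theorem exists_finiteDimensional_casimirDefect_mem [CompactSpace G]
    (hPoisson : IsPoissonAction E G π) (hm : IsMomentumMap π m) :
    ∃ W : Submodule ℝ (Casimir π), FiniteDimensional ℝ W ∧
      ∀ (g : G) (Y : GroupLieAlgebra 𝓘(ℝ, E) G), casimirDefect hPoisson hm g Y ∈ W := by
  have : IsTopologicalGroup G := topologicalGroup_of_lieGroup 𝓘(ℝ, E) ∞
  set N := Subgroup.connectedComponentOfOne G
  have hN : IsOpen (N : Set G) := isOpen_connectedComponent_one E G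
  have : Finite (G ⧸ N) := N.quotient_finite_of_isOpen hN
  -- The identity component is open, so compactness leaves finitely many cosets; each representative
  -- contributes a finite-dimensional range.
  refine ⟨cocycleSpan hm ⊔ ⨆ q : G ⧸ N, LinearMap.range (casimirDefect hPoisson hm q.out),
    inferInstance, fun g Y ↦ ?_⟩
  obtain ⟨h, hh⟩ := QuotientGroup.mk_out_eq_mul N g
  have hg : g = (QuotientGroup.mk g : G ⧸ N).out * (h : G)⁻¹ := by rw [hh]; group
  have hmem : (h : G)⁻¹ ∈ connectedComponent (1 : G) := N.inv_mem h.2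
  rw [hg, casimirDefect_mul hPoisson hm _ hmem]
  refine add_mem ?_ (le_sup_left (b := ⨆ q : G ⧸ N, LinearMap.range
    (casimirDefect hPoisson hm q.out)) (casimirDefect_mem_cocycleSpan hPoisson hm hmem _))
  exact le_sup_right (a := cocycleSpan hm)
    (le_iSup (fun q : G ⧸ N ↦ LinearMap.range (casimirDefect hPoisson hm q.out)) _ ⟨Y, rfl⟩)

theorem continuous_average [IsTopologicalGroup G] (m : SmoothMapToDual E F G P) (x : P)
    (Y : GroupLieAlgebra 𝓘(ℝ, E) G) :
    Continuous fun g : G ↦ m.toFun (g⁻¹ • x) (Ad E g⁻¹ Y) := by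
  set b := Module.finBasis ℝ E
  have h1 : (fun g : G ↦ m.toFun (g⁻¹ • x) (Ad E g⁻¹ Y)) =
      fun g : G ↦ ∑ i, b.equivFunL (adInv (E := E) Y g) i * m.component (b i) (g⁻¹ • x) := by
    ext g
    have h2 : (Ad E g⁻¹ Y : E) = ∑ i, b.equivFunL (adInv (E := E) Y g) i • b i :=
      (b.sum_repr (adInv (E := E) Y g)).symm
    have h3 := congrArg (m.toCLM (g⁻¹ • x)) h2
    rw [map_sum] at h3
    simp_rw [map_smul, smul_eq_mul] at h3
    exact h3
  rw [h1]
  refine continuous_finsetSum _ fun i _ ↦ Continuous.mul ?_ ?_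
  · exact (continuous_apply i).comp (b.equivFunL.continuous.comp (continuous_adInv (E := E) Y))
  · exact (contMDiff_orbit (E := E) (m.component (b i)) x).continuous.comp continuous_inv

-- Left invariance of Haar measure makes the average equivariant. Its difference from `m` is the
-- mean of `Ψ(g⁻¹)(Ad_{g⁻¹} Y)`, an element of the finite-dimensional `W`; thus smoothness and the
-- Casimir property need no differentiation under the integral.
open MeasureTheory in
theorem hasEquivariantMomentumMap_of_compactSpace [CompactSpace G]
    (hPoisson : IsPoissonAction E G π) (hm : IsMomentumMap π m) :
    HasEquivariantMomentumMap E G π := by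
  have : IsTopologicalGroup G := topologicalGroup_of_lieGroup 𝓘(ℝ, E) ∞
  borelize G
  set μ : Measure G := Measure.haarMeasure ⊤
  have : IsProbabilityMeasure μ :=
    ⟨Measure.haarMeasure_self (K₀ := (⊤ : TopologicalSpace.PositiveCompacts G))⟩
  obtain ⟨W, hWfin, hW⟩ := exists_finiteDimensional_casimirDefect_mem hPoisson hm
  have hint : ∀ x Y, Integrable (fun g : G ↦ m.toFun (g⁻¹ • x) (Ad E g⁻¹ Y)) μ := fun x Y ↦
    (continuous_average m x Y).integrable_of_hasCompactSupport
      (HasCompactSupport.of_compactSpace _)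
  have hdef : ∀ (g : G) (x : P) (Y : GroupLieAlgebra 𝓘(ℝ, E) G),
      m.defect g⁻¹ x (Ad E g⁻¹ Y) = m.toFun (g⁻¹ • x) (Ad E g⁻¹ Y) - m.toFun x Y := by
    intro g x Y
    have h1 := DFunLike.congr_fun (Ad_mul (E := E) g⁻¹⁻¹ g⁻¹) Y
    rw [inv_mul_cancel, Ad_one] at h1
    change m.toFun (g⁻¹ • x) (Ad E g⁻¹ Y) - m.toFun x (Ad E g⁻¹⁻¹ (Ad E g⁻¹ Y)) = _
    exact congrArg (fun Z ↦ m.toFun (g⁻¹ • x) (Ad E g⁻¹ Y) - m.toFun x Z) h1.symm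
  have hex : ∀ Y : GroupLieAlgebra 𝓘(ℝ, E) G, ∃ c : Casimir π, ∀ x,
      c.1 x = ∫ g : G, m.toFun (g⁻¹ • x) (Ad E g⁻¹ Y) ∂μ - m.toFun x Y := by
    intro Y
    obtain ⟨w, hw⟩ := exists_eq_integral (V := W)
      (ev := fun x ↦ (casimirEval π x).domRestrict W)
      (fun v hv ↦ Subtype.ext (casimirEval_separating v.1 hv)) μ
      (h := fun g ↦ ⟨casimirDefect hPoisson hm g⁻¹ (Ad E g⁻¹ Y), hW _ _⟩) (fun x ↦ by
        change Continuous fun g : G ↦ m.defect g⁻¹ x (Ad E g⁻¹ Y)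
        simp_rw [hdef]
        exact (continuous_average m x Y).sub continuous_const)
    refine ⟨w.1, fun x ↦ ?_⟩
    have h1 : w.1.1 x = ∫ g : G, m.defect g⁻¹ x (Ad E g⁻¹ Y) ∂μ := hw x
    rw [h1]
    simp_rw [hdef]
    rw [integral_sub (hint x Y) (integrable_const _)]
    simp
  choose c hc using hex
  let c' : GroupLieAlgebra 𝓘(ℝ, E) G →ₗ[ℝ] Casimir π :=
    { toFun := c
      map_add' := fun X Y ↦ by
        ext x
        change (c (X + Y)).1 x = (c X).1 x + (c Y).1 x
        simp_rw [hc, map_add]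
        rw [integral_add (hint x X) (hint x Y)]
        ring
      map_smul' := fun t X ↦ by
        ext x
        change (c (t • X)).1 x = t * (c X).1 x
        simp_rw [hc, map_smul, smul_eq_mul]
        rw [integral_const_mul]
        ring }
  have hval : ∀ x Y, (m.addCasimir c').toFun x Y =
      ∫ g : G, m.toFun (g⁻¹ • x) (Ad E g⁻¹ Y) ∂μ := by
    intro x Y
    rw [m.addCasimir_apply]
    change _ + (c Y).1 x = _
    rw [hc]
    ring
  refine ⟨m.addCasimir c', hm.addCasimir c', fun k x ↦ ?_⟩
  ext Y
  rw [LinearMap.comp_apply, hval, hval,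
    ← integral_mul_left_eq_self (fun g : G ↦ m.toFun (g⁻¹ • x) (Ad E g⁻¹ (Ad E k⁻¹ Y))) k⁻¹]
  congr 1
  ext g
  have h1 := DFunLike.congr_fun (Ad_mul (E := E) (k⁻¹ * g)⁻¹ k⁻¹) Y
  rw [show (k⁻¹ * g)⁻¹ * k⁻¹ = g⁻¹ by group] at h1
  have h2 : (k⁻¹ * g)⁻¹ • x = g⁻¹ • k • x := by simp [mul_smul]
  rw [h2]
  exact congrArg (m.toFun (g⁻¹ • k • x)) h1

end Compact

end TangentialPoisson

end

theorem mainTheorem3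
    {E : Type*} [NormedAddCommGroup E] [NormedSpace ℝ E] [FiniteDimensional ℝ E] [CompleteSpace E]
    {F : Type*} [NormedAddCommGroup F] [NormedSpace ℝ F] [FiniteDimensional ℝ F]
    {G : Type*} [TopologicalSpace G] [ChartedSpace E G] [Group G] [LieGroup 𝓘(ℝ, E) ∞ G]
    {P : Type*} [TopologicalSpace P] [ChartedSpace F P] [IsManifold 𝓘(ℝ, F) ∞ P] [T2Space P]
    [MulAction G P] [ContMDiffSMul 𝓘(ℝ, E) 𝓘(ℝ, F) ∞ G P]
    (π : PoissonStructure F P)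
    (hPoisson : IsPoissonAction E G π) (hTangential : IsTangential E G π)
    (m : SmoothMapToDual E F G P) (hm : IsMomentumMap π m) :
    -- `Γ` is a 2-cocycle of `𝔤` with values in the trivial module `Car(P)`
    (∃ Γ ∈ LieModule.Cohomology.twoCocycle ℝ (GroupLieAlgebra 𝓘(ℝ, E) G) (TrivialCasimir E G π),
      ∀ (X Y : GroupLieAlgebra 𝓘(ℝ, E) G) (x : P),
        (TrivialLieModule.equiv ℝ (GroupLieAlgebra 𝓘(ℝ, E) G) (Casimir π) (Γ X Y)).1 x =
          m.component ⁅X, Y⁆ x - π.bracket (m.component X) (m.component Y) x ∧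
        (TrivialLieModule.equiv ℝ (GroupLieAlgebra 𝓘(ℝ, E) G) (Casimir π) (Γ X Y)).1 x =
          mfderiv 𝓘(ℝ, E) 𝓘(ℝ, ℝ) (fun g : G ↦ m.defect g x Y) 1 X) ∧
    -- `Ψ` is a 1-cocycle of `G`, and it is the obstruction to equivariance
    (ConnectedSpace G →
      ∃ Ψ : G → GroupLieAlgebra 𝓘(ℝ, E) G →ₗ[ℝ] Casimir π,
        (∀ (g : G) (Y : GroupLieAlgebra 𝓘(ℝ, E) G) (x : P), (Ψ g Y).1 x = m.defect g x Y) ∧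
        IsGroupOneCocycle (coadjointRep E G (Casimir π)) Ψ ∧
        (HasEquivariantMomentumMap E G π ↔
          IsGroupOneCoboundary (coadjointRep E G (Casimir π)) Ψ)) ∧
    (CompactSpace G → HasEquivariantMomentumMap E G π) ∧
    (LieH1Vanishes (GroupLieAlgebra 𝓘(ℝ, E) G) (TrivialCasimir E G π) →
      LieH2Vanishes (GroupLieAlgebra 𝓘(ℝ, E) G) (TrivialCasimir E G π) →
      HasEquivariantMomentumMap E G π) ∧
    (LieAlgebra.IsSemisimple ℝ (GroupLieAlgebra 𝓘(ℝ, E) G) →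
      LieH1Vanishes (GroupLieAlgebra 𝓘(ℝ, E) G) (TrivialCasimir E G π) ∧
      LieH2Vanishes (GroupLieAlgebra 𝓘(ℝ, E) G) (TrivialCasimir E G π) ∧
      HasEquivariantMomentumMap E G π) := by
  refine ⟨⟨trivialCocycle hm, trivialCocycle_mem hm, fun X Y x ↦ ?_⟩, fun _ ↦ ?_, fun _ ↦
    hasEquivariantMomentumMap_of_compactSpace hPoisson hm,
    hasEquivariantMomentumMap_of_vanishing hPoisson hm, fun _ ↦ ?_⟩
  · rw [trivialCocycle_apply, LinearEquiv.apply_symm_apply]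
    exact ⟨rfl, (mfderiv_defect hm X Y x).symm⟩
  · refine ⟨casimirDefect hPoisson hm, casimirDefect_apply hPoisson hm, fun g h ↦ ?_,
      hasEquivariantMomentumMap_iff hPoisson hm⟩
    refine LinearMap.ext fun Y ↦ casimirDefect_mul hPoisson hm g ?_ Y
    rw [PreconnectedSpace.connectedComponent_eq_univ]
    trivial
  · have h1 := lieH1Vanishes_of_isKilling (GroupLieAlgebra 𝓘(ℝ, E) G) (TrivialCasimir E G π)
    have h2 := lieH2Vanishes_of_isKilling (GroupLieAlgebra 𝓘(ℝ, E) G) (TrivialCasimir E G π)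
    exact ⟨h1, h2, hasEquivariantMomentumMap_of_vanishing hPoisson hm h1 h2⟩
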